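/- Let $k\ge 1$, $S=\{1,\dots,k\}$, and let $A=(t_{ij})_{k\times k}$ be a matrix of zeros and ones with no row or column made entirely of zeros. Let $$\Sigma_A=\{(i_1,i_2,\dots)\in S^{\mathbb N}: t_{i_ji_{j+1}}=1\text{ for every } j\in\mathbb N\},\qquad \mathbb N=\{1,2,\dots\},$$ with the shift $\sigma(i_1,i_2,i_3,\dots)=(i_2,i_3,\dots)$, the cylinders $C_{i_1\dots i_n}=\{(j_1,j_2,\dots)\in\Sigma_A: j_l=i_l,\ 1\le l\le n\}$, and, for a fixed $\alpha>0$, the metric $d(\omega,\omega')=e^{-\alpha|\omega\wedge\omega'|}$ for $\omega\ne\omega'$ (and $d(\omega,\omega)=0$), where $|\omega\wedge\omega'|$ is the length of the longest common initial block of $\omega$ and $\omega'$; this metric induces the topology generated by the cylinders. Suppose that $(\Sigma_A,\sigma)$ is topologically mixing: for all $a,b\in S$ there is $N_{ab}\in\mathbb N$ such that $C_a\cap\sigma^{-n}C_b\neq\emptyset$ for every $n>N_{ab}$. For $\varphi,\psi\colon\Sigma_A\to\mathbb R$ continuous with $\psi>0$, write $S_n\varphi=\sum_{i=0}^{n-1}\varphi\circ\sigma^i$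 and, for $T>0$ and $n\in\mathbb N$, let $X_n=\{x\in\Sigma_A: S_n\psi(x)\le T<S_{n+1}\psi(x)\}$ and $S_T=\{n\in\mathbb N: X_n\ne\emptyset\}$. A set $F\subseteq\Sigma_A$ is $(n,\epsilon)$-spanning for $Z\subseteq\Sigma_A$ if for every $y\in Z$ there is $x\in F$ with $\max_{0\le i<n}d(\sigma^ix,\sigma^iy)\le\epsilon$. Put $$Q_{\psi,T}(\varphi,\epsilon)=\inf\Big\{\sum_{n\in S_T}\sum_{x\in F_n}\exp\big(S_n\varphi(x)\big): F_n\text{ is }(n,\epsilon)\text{-spanning for }X_n,\ n\in S_T\Big\},$$ $$P_\psi(\varphi)=\lim_{\epsilon\to0^+}\ \limsup_{T\to\infty}\frac1T\log Q_{\psi,T}(\varphi,\epsilon).$$ Suppose that $\varphi$ and $\psi$ are Hölder continuous and $\psi>0$. Then the limit $P_\psi(\varphi)$ exists and is finite, and there exists at least one $\sigma$-invariant Gibbs measure for $\psi$ and $\varphi$, that is, a $\sigma$-invariant Borel probability measure $\mu$ on $\Sigma_A$ for which there is a constant $K>1$ such that $$K^{-1}\le\frac{\mu(C_{i_1\dots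 i_n})}{\exp\big[-P_\psi(\varphi)\,S_n\psi(\omega)+S_n\varphi(\omega)\big]}\le K$$ for all $(i_1,i_2,\dots)\in\Sigma_A$, all $n\in\mathbb N$ and all $\omega\in C_{i_1\dots i_n}$. -/

import Mathlib

open Filter Topology MeasureTheory
open scoped NNReal ENNReal

noncomputable section

section InducedPressure

variable {X : Type*} [PseudoMetricSpace X]

/-- The set `X_n` of the points `x` with `S_n ψ (x) ≤ T < S_{n+1} ψ (x)`, where `S_n` is the
`n`-th Birkhoff sum along `f`. -/
def levelSet (f : X → X) (ψ : X → ℝ) (T : ℝ) (n : ℕ) : Set X :=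
  {x | birkhoffSum f ψ n x ≤ T ∧ T < birkhoffSum f ψ (n + 1) x}

/-- The set `S_T` of the positive integers `n` for which `X_n` is non-empty. -/
def returnTimes (f : X → X) (ψ : X → ℝ) (T : ℝ) : Set ℕ :=
  {n | 1 ≤ n ∧ (levelSet f ψ T n).Nonempty}

/-- The Bowen metric `d_n (x, y) = max {d (f^i x, f^i y) : 0 ≤ i ≤ n - 1}`. -/
def bowenDist (f : X → X) (n : ℕ) (x y : X) : ℝ :=
  ⨆ i : Fin n, dist (f^[i] x) (f^[i] y)

/-- `F ⊆ X` is an `(n, ε)`-spanning set of `Z`. -/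
def IsSpanningSet (f : X → X) (n : ℕ) (ε : ℝ) (Z F : Set X) : Prop :=
  ∀ y ∈ Z, ∃ x ∈ F, bowenDist f n x y ≤ ε

/-- `Q_{ψ,T} (f, φ, ε)`, the infimum of `∑_{n ∈ S_T} ∑_{x ∈ F_n} exp (S_n φ (x))` over all families
of `(n, ε)`-spanning sets `F_n` of `X_n`, `n ∈ S_T`. The spanning sets need not be finite, so the
sums are taken in `[0, ∞]`. -/
def spanningSum (f : X → X) (ψ φ : X → ℝ) (T ε : ℝ) : ℝ≥0∞ :=
  ⨅ (F : ℕ → Set X)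
    (_ : ∀ n ∈ returnTimes f ψ T, IsSpanningSet f n ε (levelSet f ψ T n) (F n)),
    ∑' n : returnTimes f ψ T, ∑' x : F n, ENNReal.ofReal (Real.exp (birkhoffSum f φ n x))

/-- `limsup_{T → ∞} (1 / T) log Q_{ψ,T} (f, φ, ε)`, an extended real number. -/
def inducedPressureAt (f : X → X) (ψ φ : X → ℝ) (ε : ℝ) : EReal :=
  limsup (fun T : ℝ => ((1 / T : ℝ) : EReal) * ENNReal.log (spanningSum f ψ φ T ε)) atTop

/-- The real number `P` is the `ψ`-induced topological pressure `P_ψ (φ)` of `φ` with respect to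
`f`: the limit `lim_{ε → 0} limsup_{T → ∞} (1 / T) log Q_{ψ,T} (f, φ, ε)` exists and is `P`. -/
def IsInducedPressure (f : X → X) (ψ φ : X → ℝ) (P : ℝ) : Prop :=
  Tendsto (inducedPressureAt f ψ φ) (𝓝[>] 0) (𝓝 (P : EReal))

/-- Hölder continuity of a real function, with some positive exponent. -/
def IsHolderContinuous (φ : X → ℝ) : Prop :=
  ∃ C r : ℝ≥0, 0 < r ∧ HolderWith C r φ

end InducedPressure

section MarkovShift

variable {k : ℕ}

/-- A matrix of zeros and ones with no row and no column made entirely of zeros. -/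
structure IsTransitionMatrix (A : Matrix (Fin k) (Fin k) ℕ) : Prop where
  zero_or_one : ∀ i j, A i j = 0 ∨ A i j = 1
  row_ne_zero : ∀ i, ∃ j, A i j ≠ 0
  col_ne_zero : ∀ j, ∃ i, A i j ≠ 0

/-- The space `Σ_A` of one-sided sequences over `k` symbols with all transitions allowed by `A`.
It carries the subspace topology of the product of discrete spaces, that is, the topology generated
by the cylinders, and the corresponding Borel σ-algebra. -/
abbrev MarkovShift (A : Matrix (Fin k) (Fin k) ℕ) : Type :=
  {ω : ℕ → Fin k // ∀ j, A (ω j) (ω (j + 1)) = 1}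

variable (A : Matrix (Fin k) (Fin k) ℕ)

/-- The shift map `σ (i₁, i₂, i₃, …) = (i₂, i₃, …)`. -/
def shiftMap (ω : MarkovShift A) : MarkovShift A :=
  ⟨fun j => ω.1 (j + 1), fun j => ω.2 (j + 1)⟩

/-- The cylinder of the points that agree with `ω` in the first `n` symbols. -/
def shiftCylinder (ω : MarkovShift A) (n : ℕ) : Set (MarkovShift A) :=
  {τ | ∀ l < n, τ.1 l = ω.1 l}

/-- The cylinder of the points whose first symbol is `a`. -/
def symbolCylinder (a : Fin k) : Set (MarkovShift A) :=
  {τ | τ.1 0 = a}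

/-- Topological mixing: for all symbols `a`, `b`, the set `C_a ∩ σ⁻ⁿ C_b` is non-empty for all
large `n`. -/
def IsTopologicallyMixing : Prop :=
  ∀ a b : Fin k, ∃ N : ℕ, ∀ n > N,
    (symbolCylinder A a ∩ (shiftMap A)^[n] ⁻¹' symbolCylinder A b).Nonempty

open scoped Classical in
/-- The distance `exp (- α |ω ∧ τ|)`, where `|ω ∧ τ|` is the length of the longest common initial
block of `ω ≠ τ` (the least index, counted from `0`, at which they differ). -/
def shiftDist (α : ℝ) (ω τ : MarkovShift A) : ℝ :=
  if ω = τ then 0 else Real.exp (-α * (PiNat.firstDiff ω.1 τ.1 : ℝ))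

theorem shiftDist_le_of_mem_cylinder {α : ℝ} (hα : 0 < α) (ω τ : MarkovShift A) (n : ℕ)
    (h : τ.1 ∈ PiNat.cylinder ω.1 n) : shiftDist A α ω τ ≤ Real.exp (-α * n) := by
  unfold shiftDist
  split_ifs with e
  · positivity
  · have hne : ω.1 ≠ τ.1 := fun h => e (Subtype.ext h)
    have := (PiNat.mem_cylinder_iff_le_firstDiff hne.symm n).1 h
    rw [PiNat.firstDiff_comm] at this
    have h2 : (n : ℝ) ≤ (PiNat.firstDiff ω.1 τ.1 : ℝ) := by exact_mod_cast this
    apply Real.exp_le_exp.2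
    nlinarith

theorem mem_cylinder_of_shiftDist_lt {α : ℝ} (hα : 0 < α) (ω τ : MarkovShift A) (n : ℕ)
    (h : shiftDist A α ω τ < Real.exp (-α * n)) : τ.1 ∈ PiNat.cylinder ω.1 n := by
  unfold shiftDist at h
  split_ifs at h with e
  · subst e
    exact PiNat.self_mem_cylinder _ _
  · have hne : ω.1 ≠ τ.1 := fun h => e (Subtype.ext h)
    rw [PiNat.mem_cylinder_iff_le_firstDiff hne.symm, PiNat.firstDiff_comm]
    have h2 := Real.exp_lt_exp.1 h
    have h3 : (n : ℝ) < (PiNat.firstDiff ω.1 τ.1 : ℝ) := by nlinarith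
    exact_mod_cast h3.le

theorem isOpen_iff_shiftDist {α : ℝ} (hα : 0 < α) (s : Set (MarkovShift A)) :
    IsOpen s ↔ ∀ ω ∈ s, ∃ ε > 0, ∀ τ, shiftDist A α ω τ < ε → τ ∈ s := by
  constructor
  · intro hs ω hω
    obtain ⟨U, hU, rfl⟩ := isOpen_induced_iff.1 hs
    obtain ⟨v, ⟨x, n, rfl⟩, hv, hvU⟩ :=
      (PiNat.isTopologicalBasis_cylinders (fun _ : ℕ => Fin k)).exists_subset_of_mem_open hω hU
    rw [← PiNat.mem_cylinder_iff_eq.1 hv] at hvU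
    exact ⟨_, Real.exp_pos (-α * n), fun τ hτ =>
      hvU (mem_cylinder_of_shiftDist_lt A hα ω τ n hτ)⟩
  · intro h
    rw [isOpen_iff_forall_mem_open]
    intro ω hω
    obtain ⟨ε, hε, H⟩ := h ω hω
    obtain ⟨n, hn⟩ := exists_nat_gt (-Real.log ε / α)
    refine ⟨Subtype.val ⁻¹' PiNat.cylinder ω.1 n, fun τ hτ => H τ ?_,
      (PiNat.isOpen_cylinder _ _ _).preimage continuous_subtype_val, PiNat.self_mem_cylinder _ _⟩
    refine (shiftDist_le_of_mem_cylinder A hα ω τ n hτ).trans_lt ?_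
    rw [← Real.lt_log_iff_exp_lt hε]
    rw [div_lt_iff₀ hα] at hn
    nlinarith

/-- The metric `d_α` on `Σ_A`; it induces the topology generated by the cylinders. -/
abbrev shiftMetric (α : ℝ) (hα : 0 < α) : MetricSpace (MarkovShift A) :=
  MetricSpace.ofDistTopology (shiftDist A α)
    (fun ω => by simp [shiftDist])
    (fun ω τ => by
      by_cases h : ω = τ
      · rw [h]
      · unfold shiftDist
        rw [if_neg h, if_neg (Ne.symm h), PiNat.firstDiff_comm])
    (fun ω τ ρ => by
      by_cases h1 : ω = ρ
      · have h0 : ∀ a b : MarkovShift A, 0 ≤ shiftDist A α a b := fun a b => by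
          unfold shiftDist
          split_ifs <;> positivity
        have : shiftDist A α ω ρ = 0 := by simp [shiftDist, h1]
        rw [this]
        exact add_nonneg (h0 _ _) (h0 _ _)
      by_cases h2 : ω = τ
      · subst h2
        simp [shiftDist]
      by_cases h3 : τ = ρ
      · subst h3
        simp [shiftDist]
      simp only [shiftDist, h1, h2, h3, if_false]
      have hne : ω.1 ≠ ρ.1 := fun h => h1 (Subtype.ext h)
      have hp1 := Real.exp_pos (-α * (PiNat.firstDiff ω.1 τ.1 : ℝ))
      have hp2 := Real.exp_pos (-α * (PiNat.firstDiff τ.1 ρ.1 : ℝ))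
      rcases min_le_iff.1 (PiNat.min_firstDiff_le ω.1 τ.1 ρ.1 hne) with h | h
      · have h' : (PiNat.firstDiff ω.1 τ.1 : ℝ) ≤ (PiNat.firstDiff ω.1 ρ.1 : ℝ) := by
          exact_mod_cast h
        have := Real.exp_le_exp.2
          (show -α * (PiNat.firstDiff ω.1 ρ.1 : ℝ) ≤ -α * (PiNat.firstDiff ω.1 τ.1 : ℝ) by nlinarith)
        linarith
      · have h' : (PiNat.firstDiff τ.1 ρ.1 : ℝ) ≤ (PiNat.firstDiff ω.1 ρ.1 : ℝ) := by
          exact_mod_cast h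
        have := Real.exp_le_exp.2
          (show -α * (PiNat.firstDiff ω.1 ρ.1 : ℝ) ≤ -α * (PiNat.firstDiff τ.1 ρ.1 : ℝ) by nlinarith)
        linarith)
    (isOpen_iff_shiftDist A hα)
    (fun ω τ h => by
      by_contra hne
      simp only [shiftDist, hne, if_false] at h
      exact (Real.exp_pos _).ne' h)

/-- The probability measure `μ` on `Σ_A` is a Gibbs measure for `ψ` and `φ`: for `P = P_ψ (φ)`
(computed in the metric `d_α`) there is `K > 1` such that
`K⁻¹ ≤ μ (C_{i₁ … iₙ}) / exp (- P S_n ψ (ω) + S_n φ (ω)) ≤ K` for all `(i₁, i₂, …) ∈ Σ_A`,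
all `n ≥ 1` and all `ω ∈ C_{i₁ … iₙ}`. -/
def IsGibbsMeasure (α : ℝ) (hα : 0 < α) (ψ φ : MarkovShift A → ℝ)
    (μ : Measure (MarkovShift A)) : Prop :=
  letI := shiftMetric A α hα
  IsProbabilityMeasure μ ∧
    ∃ P : ℝ, IsInducedPressure (shiftMap A) ψ φ P ∧
      ∃ K : ℝ, 1 < K ∧ ∀ ι : MarkovShift A, ∀ n : ℕ, 1 ≤ n → ∀ ω ∈ shiftCylinder A ι n,
        K⁻¹ ≤ μ.real (shiftCylinder A ι n) /
            Real.exp (-(birkhoffSum (shiftMap A) ψ n ω) * P + birkhoffSum (shiftMap A) φ n ω) ∧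
          μ.real (shiftCylinder A ι n) /
            Real.exp (-(birkhoffSum (shiftMap A) ψ n ω) * P + birkhoffSum (shiftMap A) φ n ω) ≤ K

end MarkovShift

end

/-! The proof is Ruelle's thermodynamic formalism with Banach limits in place of spectral theory.
For `g = φ - β ψ`, the iterate `(Lⁿ 1)(x)` of the transfer operator is the sum of `exp (S_n g (y))`
over `σⁿ y = x`. Hölder continuity bounds the distortion of Birkhoff sums on cylinders, and mixing
then makes `Lⁿ 1` comparable at any two points, uniformly in `n`
(`exists_transferOperator_pow_one_le_mul`). Hence `log Lⁿ 1` is additive up to a bounded error and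
equals `n p(β) + O(1)`. The function `p` is Lipschitz and, because `ψ ≥ c > 0`, decreases at rate at
least `c`, so it vanishes at some `P`. There `Lⁿ 1` stays between positive constants
(`exists_transferOperator_pow_one_bounded`).

For this `P`, a Banach limit of `Lʲ f (x₀)` is a positive functional `ν` with `ν ∘ L = ν`, the
substitute for a conformal measure. A second Banach limit, of `ν (f ∘ σʲ) = ν (Lʲ 1 · f)`, gives a
shift-invariant functional comparable with `ν` (`exists_invariant_gibbs_functional`). Evaluating `ν`
on the indicator of an `n`-cylinder through `Lⁿ` leaves at most one preimage, which gives the upper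
Gibbs bound; mixing supplies a preimage under `σ^(n + M)` for the lower one. The Riesz
representation theorem turns the functional into a measure, and the bounds survive because cylinders
are clopen.

The Gibbs bounds identify `P` as the induced pressure. On `X_n` one has `S_n ψ = T + O(1)`, so an
`n`-cylinder meeting `X_n` has measure comparable to `exp (S_n φ - P T)`. The sets `X_n` cover the
space for large `T`, and only `O(T)` of them are non-empty. So the spanning sums lie between
constant multiples of `exp (P T)` and `T exp (P T)`. -/

/-! ### Words, preimages and the transfer operator -/

section TransferOperator

variable {k : ℕ} {A : Matrix (Fin k) (Fin k) ℕ}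

/-- The point `a x₀ x₁ …`. -/
def MarkovShift.cons (a : Fin k) (x : MarkovShift A) (h : A a (x.1 0) = 1) : MarkovShift A :=
  ⟨fun n => Nat.casesOn n a x.1, fun j => by
    cases j with
    | zero => exact h
    | succ j => exact x.2 j⟩

theorem shiftMap_cons (a : Fin k) (x : MarkovShift A) (h : A a (x.1 0) = 1) :
    shiftMap A (MarkovShift.cons a x h) = x := rfl

theorem cons_shiftMap (x : MarkovShift A) :
    MarkovShift.cons (x.1 0) (shiftMap A x) (x.2 0) = x := by
  apply Subtype.ext
  funext n
  cases n <;> rfl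

/-- The point `ω₀ … ωₙ₋₁ x₀ x₁ …`. -/
def MarkovShift.splice (ω x : MarkovShift A) (n : ℕ) (h : ω.1 n = x.1 0) : MarkovShift A :=
  ⟨fun j => if j < n then ω.1 j else x.1 (j - n), fun j => by
    rcases lt_trichotomy (j + 1) n with h1 | h1 | h1
    · simp only [h1, (Nat.lt_succ_self j).trans h1, if_true]
      exact ω.2 j
    · subst h1
      simp only [Nat.lt_succ_self, if_true, lt_irrefl, if_false, Nat.sub_self, ← h]
      exact ω.2 j
    · have h2 : ¬ j < n := by omega
      have h3 : ¬ j + 1 < n := by omega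
      have h4 : j + 1 - n = j - n + 1 := by omega
      simp only [h2, h3, if_false, h4]
      exact x.2 _⟩

theorem iterate_shiftMap_apply (n : ℕ) (x : MarkovShift A) (j : ℕ) :
    ((shiftMap A)^[n] x).1 j = x.1 (j + n) := by
  induction n generalizing x with
  | zero => rfl
  | succ n ih => rw [Function.iterate_succ_apply, ih]; rfl

theorem iterate_shiftMap_splice (ω x : MarkovShift A) (n : ℕ) (h : ω.1 n = x.1 0) :
    (shiftMap A)^[n] (ω.splice x n h) = x := by
  apply Subtype.ext
  funext j
  rw [iterate_shiftMap_apply]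
  simp [MarkovShift.splice]

theorem splice_mem_shiftCylinder (ω x : MarkovShift A) (n : ℕ) (h : ω.1 n = x.1 0) :
    ω.splice x n h ∈ shiftCylinder A ω (n + 1) := by
  intro l hl
  rcases Nat.lt_succ_iff_lt_or_eq.1 hl with h1 | rfl
  · simp [MarkovShift.splice, h1]
  · simp [MarkovShift.splice, h]

/-- In a mixing shift, every cylinder of length `n + 1` contains, for some fixed `M`, a point of
every fibre of `σ^(n + M)`. -/
theorem IsTopologicallyMixing.exists_iterate_eq (hmix : IsTopologicallyMixing A) :
    ∃ M : ℕ, ∀ (ω x : MarkovShift A) (n : ℕ),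
      ∃ y ∈ shiftCylinder A ω (n + 1), (shiftMap A)^[n + M] y = x := by
  choose N hN using hmix
  -- One transition time that exceeds every mixing threshold `N a b`. The point sought is a block of
  -- `ω`, then a block of length `M` leading from `ω n` to `x 0`, then `x`.
  let M := (∑ a, ∑ b, N a b) + 1
  have hM : ∀ a b, M > N a b := fun a b => by
    have h1 : N a b ≤ ∑ b, N a b :=
      Finset.single_le_sum (f := fun b => N a b) (fun _ _ => Nat.zero_le _) (Finset.mem_univ b)
    have h2 : ∑ b, N a b ≤ ∑ a, ∑ b, N a b :=
      Finset.single_le_sum (f := fun a => ∑ b, N a b) (fun _ _ => Nat.zero_le _)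
        (Finset.mem_univ a)
    omega
  refine ⟨M, fun ω x n => ?_⟩
  obtain ⟨τ, hτ0, hτM⟩ := hN (ω.1 n) (x.1 0) M (hM _ _)
  have hτM' : τ.1 M = x.1 0 := by
    have h : ((shiftMap A)^[M] τ).1 0 = x.1 0 := hτM
    rwa [iterate_shiftMap_apply, zero_add] at h
  have hz : ω.1 n = (τ.splice x M hτM').1 0 :=
    (splice_mem_shiftCylinder τ x M hτM' 0 (by omega)).symm ▸ hτ0.symm
  refine ⟨ω.splice _ n hz, splice_mem_shiftCylinder _ _ _ _, ?_⟩
  rw [add_comm, Function.iterate_add_apply, iterate_shiftMap_splice, iterate_shiftMap_splice]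

open scoped Classical in
/-- The transfer operator `L f (x) = ∑_{σ y = x} exp (g y) f y`. -/
noncomputable def transferOperator (g : MarkovShift A → ℝ) :
    Module.End ℝ (MarkovShift A → ℝ) where
  toFun f x := ∑ a : Fin k, if h : A a (x.1 0) = 1 then
    Real.exp (g (MarkovShift.cons a x h)) * f (MarkovShift.cons a x h) else 0
  map_add' f₁ f₂ := by
    funext x
    simp only [Pi.add_apply]
    rw [← Finset.sum_add_distrib]
    refine Finset.sum_congr rfl fun a _ => ?_
    split_ifs <;> simp [mul_add]
  map_smul' c f := by
    funext x
    simp only [Pi.smul_apply, smul_eq_mul, RingHom.id_apply, Finset.mul_sum]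
    refine Finset.sum_congr rfl fun a _ => ?_
    split_ifs <;> ring

open scoped Classical in
theorem transferOperator_apply (g f : MarkovShift A → ℝ) (x : MarkovShift A) :
    transferOperator g f x = ∑ a : Fin k, if h : A a (x.1 0) = 1 then
      Real.exp (g (MarkovShift.cons a x h)) * f (MarkovShift.cons a x h) else 0 := rfl

theorem transferOperator_mono (g : MarkovShift A → ℝ) {f₁ f₂ : MarkovShift A → ℝ}
    (h : ∀ x, f₁ x ≤ f₂ x) (x : MarkovShift A) :
    transferOperator g f₁ x ≤ transferOperator g f₂ x := by
  classical
  rw [transferOperator_apply, transferOperator_apply]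
  refine Finset.sum_le_sum fun a _ => ?_
  split_ifs with ha
  · exact mul_le_mul_of_nonneg_left (h _) (Real.exp_pos _).le
  · exact le_rfl

theorem transferOperator_pow_mono (g : MarkovShift A → ℝ) (n : ℕ) {f₁ f₂ : MarkovShift A → ℝ}
    (h : ∀ x, f₁ x ≤ f₂ x) (x : MarkovShift A) :
    (transferOperator g ^ n) f₁ x ≤ (transferOperator g ^ n) f₂ x := by
  induction n generalizing f₁ f₂ with
  | zero => exact h x
  | succ n ih =>
    rw [pow_succ]
    exact ih (transferOperator_mono g h)

/-- All preimages of `x` give `f ∘ σ` the same value `f x`, which therefore leaves the sum. This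
identity is the source of shift invariance. -/
theorem transferOperator_comp_mul (g f h : MarkovShift A → ℝ) :
    transferOperator g (fun x => h x * f (shiftMap A x)) =
      fun x => transferOperator g h x * f x := by
  classical
  funext x
  rw [transferOperator_apply, transferOperator_apply, Finset.sum_mul]
  refine Finset.sum_congr rfl fun a _ => ?_
  split_ifs
  · rw [shiftMap_cons]; ring
  · ring

theorem exp_mul_le_transferOperator (g : MarkovShift A → ℝ) {f : MarkovShift A → ℝ}
    (hf : ∀ x, 0 ≤ f x) (y : MarkovShift A) :
    Real.exp (g y) * f y ≤ transferOperator g f (shiftMap A y) := by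
  classical
  rw [transferOperator_apply]
  have h0 : A (y.1 0) ((shiftMap A y).1 0) = 1 := y.2 0
  refine le_trans (le_of_eq ?_) (Finset.single_le_sum (f := fun a : Fin k =>
    if h : A a ((shiftMap A y).1 0) = 1 then
      Real.exp (g (MarkovShift.cons a _ h)) * f (MarkovShift.cons a _ h) else 0) (fun a _ => ?_)
    (Finset.mem_univ (y.1 0)))
  · simp only [h0, dite_true, cons_shiftMap]
  · split_ifs
    · exact mul_nonneg (Real.exp_pos _).le (hf _)
    · exact le_rfl

/-- For non-negative `f` a sum over a fibre dominates each of its terms; this gives every lower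
bound on the iterates. -/
theorem exp_mul_le_transferOperator_pow (g : MarkovShift A → ℝ) (n : ℕ) {f : MarkovShift A → ℝ}
    (hf : ∀ x, 0 ≤ f x) (y : MarkovShift A) :
    Real.exp (birkhoffSum (shiftMap A) g n y) * f y ≤
      (transferOperator g ^ n) f ((shiftMap A)^[n] y) := by
  induction n generalizing f y with
  | zero => simp
  | succ n ih =>
    have hLf : ∀ x, 0 ≤ transferOperator g f x := fun x => by
      have := transferOperator_mono g (f₁ := 0) hf x
      simpa using this
    rw [pow_succ, birkhoffSum_succ', Function.iterate_succ_apply, add_comm, Real.exp_add, mul_assoc]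
    exact (mul_le_mul_of_nonneg_left (exp_mul_le_transferOperator g hf y)
      (Real.exp_pos _).le).trans (ih hLf _)

/-- Comparison of the iterates of the transfer operator at two points with the same first
symbol. -/
theorem transferOperator_pow_le_of_forall_fiber (g : MarkovShift A → ℝ) (n : ℕ)
    {f₁ f₂ : MarkovShift A → ℝ} {x₁ x₂ : MarkovShift A} (hx : x₁.1 0 = x₂.1 0)
    (h : ∀ y₁ y₂, (shiftMap A)^[n] y₁ = x₁ → (shiftMap A)^[n] y₂ = x₂ →
      y₁ ∈ shiftCylinder A y₂ (n + 1) →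
      Real.exp (birkhoffSum (shiftMap A) g n y₁) * f₁ y₁ ≤
        Real.exp (birkhoffSum (shiftMap A) g n y₂) * f₂ y₂) :
    (transferOperator g ^ n) f₁ x₁ ≤ (transferOperator g ^ n) f₂ x₂ := by
  classical
  induction n generalizing f₁ f₂ with
  | zero =>
    have := h x₁ x₂ rfl rfl (fun l hl => by
      obtain rfl : l = 0 := by omega
      exact hx)
    simpa using this
  | succ n ih =>
    rw [pow_succ]
    refine ih fun z₁ z₂ h₁ h₂ hz => ?_
    rw [transferOperator_apply, transferOperator_apply, Finset.mul_sum, Finset.mul_sum]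
    refine Finset.sum_le_sum fun a _ => ?_
    have hz0 : z₁.1 0 = z₂.1 0 := hz 0 (by omega)
    simp only [hz0]
    split_ifs with ha
    · have ha' : A a (z₁.1 0) = 1 := hz0 ▸ ha
      have := h (MarkovShift.cons a z₁ ha') (MarkovShift.cons a z₂ ha)
        (by rw [Function.iterate_succ_apply, shiftMap_cons, h₁])
        (by rw [Function.iterate_succ_apply, shiftMap_cons, h₂])
        (fun l hl => by
          cases l with
          | zero => rfl
          | succ l => exact hz l (by omega))
      simp only [birkhoffSum_succ', shiftMap_cons, Real.exp_add] at this
      linarith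
    · simp

/-- A function supported on a cylinder of length `n` has at most one contribution to each value of
the `n`-th iterate of the transfer operator. -/
theorem transferOperator_pow_le_of_support (g : MarkovShift A → ℝ) (n : ℕ)
    {f : MarkovShift A → ℝ} (ω : MarkovShift A) {B : ℝ} (hB : 0 ≤ B)
    (hsupp : ∀ y, y ∉ shiftCylinder A ω n → f y = 0)
    (h : ∀ y ∈ shiftCylinder A ω n, Real.exp (birkhoffSum (shiftMap A) g n y) * f y ≤ B)
    (x : MarkovShift A) : (transferOperator g ^ n) f x ≤ B := by
  classical
  induction n generalizing f ω with
  | zero => simpa using h x (fun l hl => by omega)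
  | succ n ih =>
    rw [pow_succ]
    have key : ∀ z a (ha : A a (z.1 0) = 1),
        MarkovShift.cons a z ha ∈ shiftCylinder A ω (n + 1) →
        a = ω.1 0 ∧ z ∈ shiftCylinder A (shiftMap A ω) n := fun z a ha hmem =>
      ⟨hmem 0 (by omega), fun l hl => hmem (l + 1) (by omega)⟩
    -- `L f` is supported on the `n`-cylinder of `σ ω`, and only the preimage with first symbol `ω
    -- 0` contributes to it.
    refine ih (shiftMap A ω) (fun z hz => ?_) (fun z _ => ?_)
    · rw [transferOperator_apply]
      refine Finset.sum_eq_zero fun a _ => ?_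
      split_ifs with ha
      · rw [hsupp _ fun hc => hz (key z a ha hc).2, mul_zero]
      · rfl
    · rw [transferOperator_apply, Finset.sum_eq_single (ω.1 0)]
      · split_ifs with ha
        · by_cases hc : MarkovShift.cons (ω.1 0) z ha ∈ shiftCylinder A ω (n + 1)
          · have := h _ hc
            simp only [birkhoffSum_succ', shiftMap_cons, Real.exp_add] at this
            linarith
          · rw [hsupp _ hc]
            simpa using hB
        · simpa using hB
      · intro a _ hne
        split_ifs with ha
        · rw [hsupp _ fun hc => hne (key z a ha hc).1, mul_zero]
        · rfl
      · simp

/-! ### Bounded distortion and the growth rate of the iterates -/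

/-- Birkhoff sums along cylinders vary by at most `D`. -/
def HasBoundedDistortion (g : MarkovShift A → ℝ) (D : ℝ) : Prop :=
  ∀ n x, ∀ y ∈ shiftCylinder A x n,
    |birkhoffSum (shiftMap A) g n y - birkhoffSum (shiftMap A) g n x| ≤ D

theorem abs_birkhoffSum_le {g : MarkovShift A → ℝ} {G : ℝ} (hG : ∀ x, |g x| ≤ G) (n : ℕ)
    (x : MarkovShift A) : |birkhoffSum (shiftMap A) g n x| ≤ n * G := by
  rw [birkhoffSum]
  refine (Finset.abs_sum_le_sum_abs _ _).trans ((Finset.sum_le_sum fun i _ => hG _).trans ?_)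
  simp

theorem abs_sub_mul_le {φ ψ : MarkovShift A → ℝ} {B B' : ℝ} (hφ : ∀ x, |φ x| ≤ B)
    (hψ : ∀ x, |ψ x| ≤ B') (β : ℝ) (x : MarkovShift A) : |φ x - β * ψ x| ≤ B + |β| * B' := by
  refine (abs_sub _ _).trans (add_le_add (hφ x) ?_)
  rw [abs_mul]
  exact mul_le_mul_of_nonneg_left (hψ x) (abs_nonneg _)

theorem birkhoffSum_sub_mul (φ ψ : MarkovShift A → ℝ) (β : ℝ) (n : ℕ) (x : MarkovShift A) :
    birkhoffSum (shiftMap A) (fun x => φ x - β * ψ x) n x =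
      birkhoffSum (shiftMap A) φ n x - β * birkhoffSum (shiftMap A) ψ n x := by
  simp only [birkhoffSum, Finset.sum_sub_distrib, Finset.mul_sum]

theorem HasBoundedDistortion.sub_mul {φ ψ : MarkovShift A → ℝ} {D D' : ℝ}
    (hφ : HasBoundedDistortion φ D) (hψ : HasBoundedDistortion ψ D') (β : ℝ) :
    HasBoundedDistortion (fun x => φ x - β * ψ x) (D + |β| * D') := by
  intro n x y hy
  rw [birkhoffSum_sub_mul, birkhoffSum_sub_mul]
  have h2 := mul_le_mul_of_nonneg_left (hψ n x y hy) (abs_nonneg β)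
  rw [← abs_mul] at h2
  refine le_trans (le_of_eq ?_) ((abs_sub _ _).trans (add_le_add (hφ n x y hy) h2))
  congr 1
  ring

theorem transferOperator_pow_one_le {g : MarkovShift A → ℝ} {G : ℝ} (hG : ∀ x, |g x| ≤ G) (n : ℕ)
    (x : MarkovShift A) : (transferOperator g ^ n) 1 x ≤ (k * Real.exp G) ^ n := by
  classical
  induction n with
  | zero => simp
  | succ n ih =>
    rw [pow_succ, Module.End.mul_apply]
    have h1 : ∀ y, transferOperator g 1 y ≤ ((k * Real.exp G) • (1 : MarkovShift A → ℝ)) y := by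
      intro y
      rw [transferOperator_apply]
      refine (Finset.sum_le_card_nsmul _ _ (Real.exp G) fun a _ => ?_).trans (by simp)
      split_ifs
      · simpa using (le_abs_self _).trans (hG _)
      · exact (Real.exp_pos _).le
    refine (transferOperator_pow_mono g n h1 x).trans ?_
    rw [map_smul, Pi.smul_apply, smul_eq_mul, pow_succ, mul_comm]
    exact mul_le_mul_of_nonneg_right ih (by positivity)

theorem exists_iterate_shiftMap_eq (hA : IsTransitionMatrix A) (n : ℕ) (x : MarkovShift A) :
    ∃ y, (shiftMap A)^[n] y = x := by
  induction n with
  | zero => exact ⟨x, rfl⟩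
  | succ n ih =>
    obtain ⟨y, hy⟩ := ih
    obtain ⟨a, ha⟩ := hA.col_ne_zero (y.1 0)
    refine ⟨MarkovShift.cons a y ((hA.zero_or_one _ _).resolve_left ha), ?_⟩
    rw [Function.iterate_succ_apply, shiftMap_cons, hy]

theorem transferOperator_pow_one_pos (hA : IsTransitionMatrix A) (g : MarkovShift A → ℝ) (n : ℕ)
    (x : MarkovShift A) : 0 < (transferOperator g ^ n) 1 x := by
  obtain ⟨y, rfl⟩ := exists_iterate_shiftMap_eq hA n x
  have := exp_mul_le_transferOperator_pow g n (f := 1) (fun _ => zero_le_one) y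
  exact (by simpa using Real.exp_pos _ : (0 : ℝ) < _).trans_le this

/-- The iterates `Lⁿ 1` are comparable at all points, uniformly in `n`. -/
theorem exists_transferOperator_pow_one_le_mul (hA : IsTransitionMatrix A)
    (hmix : IsTopologicallyMixing A) {g : MarkovShift A → ℝ} {G D : ℝ} (hG : ∀ x, |g x| ≤ G)
    (hD : HasBoundedDistortion g D) :
    ∃ C : ℝ, 1 ≤ C ∧ ∀ n x x', (transferOperator g ^ n) 1 x ≤ C * (transferOperator g ^ n) 1 x' := by
  obtain ⟨M, hM⟩ := hmix.exists_iterate_eq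
  -- Choose `y` with the first symbol of `x` and `σ^M y = x'`. Passing from `x` to `y` costs `exp
  -- D`, the single branch from `y` to `x'` costs `exp (M G)`, and `L^M 1` is at most the last
  -- factor.
  let R := Real.exp D * (Real.exp (M * G) * (k * Real.exp G) ^ M)
  refine ⟨max 1 R, le_max_left _ _, fun n x x' => ?_⟩
  obtain ⟨y, hy, hyx⟩ := hM x x' 0
  rw [zero_add] at hyx
  have hxy : x.1 0 = y.1 0 := (hy 0 (by omega)).symm
  have h1 : (transferOperator g ^ n) 1 x ≤ Real.exp D * (transferOperator g ^ n) 1 y := by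
    have := transferOperator_pow_le_of_forall_fiber g n (f₁ := 1) (f₂ := Real.exp D • 1) hxy
      (fun y₁ y₂ _ _ h12 => by
        have := (abs_le.1 (hD n y₂ y₁ fun l hl => h12 l (by omega))).2
        simp only [Pi.one_apply, mul_one, Pi.smul_apply, smul_eq_mul]
        rw [← Real.exp_add, Real.exp_le_exp]
        linarith)
    simpa only [map_smul, Pi.smul_apply, smul_eq_mul] using this
  have hpos : ∀ z, 0 ≤ (transferOperator g ^ n) 1 z := fun z =>
    (transferOperator_pow_one_pos hA g n z).le
  have h2 : Real.exp (-(M * G)) * (transferOperator g ^ n) 1 y ≤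
      (transferOperator g ^ M) ((transferOperator g ^ n) 1) x' := by
    have h := exp_mul_le_transferOperator_pow g M hpos y
    rw [hyx] at h
    refine le_trans (mul_le_mul_of_nonneg_right (Real.exp_le_exp.2 ?_) (hpos y)) h
    exact (abs_le.1 (abs_birkhoffSum_le hG M y)).1
  have h3 : (transferOperator g ^ M) ((transferOperator g ^ n) 1) x' ≤
      (k * Real.exp G) ^ M * (transferOperator g ^ n) 1 x' := by
    rw [← Module.End.mul_apply, ← pow_add, add_comm, pow_add, Module.End.mul_apply]
    have := transferOperator_pow_mono g n (f₁ := (transferOperator g ^ M) 1)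
      (f₂ := ((k * Real.exp G) ^ M) • 1)
      (fun z => by simpa using transferOperator_pow_one_le hG M z) x'
    simpa only [map_smul, Pi.smul_apply, smul_eq_mul] using this
  have h4 : (transferOperator g ^ n) 1 y ≤
      Real.exp (M * G) * ((k * Real.exp G) ^ M * (transferOperator g ^ n) 1 x') := by
    have := mul_le_mul_of_nonneg_left (h2.trans h3) (Real.exp_pos (M * G)).le
    rwa [← mul_assoc, ← Real.exp_add, add_neg_cancel, Real.exp_zero, one_mul] at this
  calc _ ≤ _ := h1
    _ ≤ _ := mul_le_mul_of_nonneg_left h4 (Real.exp_pos D).le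
    _ = R * (transferOperator g ^ n) 1 x' := by ring
    _ ≤ _ := mul_le_mul_of_nonneg_right (le_max_right _ _) (hpos x')

/-- A sequence that is additive up to a bounded error is linear up to a bounded error. -/
theorem exists_abs_sub_mul_le_of_quasiadditive {a : ℕ → ℝ} {C : ℝ}
    (h : ∀ m n, |a (m + n) - a m - a n| ≤ C) : ∃ p, ∀ n, |a n - n * p| ≤ C := by
  have hC : 0 ≤ C := (abs_nonneg _).trans (h 0 0)
  -- Both `a + C` and `C - a` are subadditive. By Fekete each divided by `n` tends to its infimum,
  -- and the two limits are opposite, which bounds `a n - n p` on both sides.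
  have hup : Subadditive fun n => a n + C := fun m n => by
    have := (abs_le.1 (h m n)).2
    dsimp only
    linarith
  have hlo : Subadditive fun n => C - a n := fun m n => by
    have := (abs_le.1 (h m n)).1
    dsimp only
    linarith
  have hlin : ∀ n, |a n| ≤ n * (|a 1| + C) + C := fun n => by
    induction n with
    | zero =>
      have := abs_le.1 (h 0 0)
      rw [abs_le]
      constructor <;> push_cast <;> linarith
    | succ n ih =>
      have h1 := abs_le.1 (h n 1)
      have h2 := abs_le.1 ih
      have h3 := abs_le.1 (le_refl |a 1|)
      rw [abs_le]
      constructor <;> push_cast <;> linarith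
  have hdiv : ∀ n : ℕ, |a n / n| ≤ |a 1| + C + C := fun n => by
    rcases Nat.eq_zero_or_pos n with rfl | hn
    · simp; positivity
    · have hn' : (1 : ℝ) ≤ n := by exact_mod_cast hn
      rw [abs_div, Nat.abs_cast, div_le_iff₀ (by linarith)]
      have := hlin n
      nlinarith
  have hCdiv : ∀ n : ℕ, 0 ≤ C / n ∧ C / n ≤ C := fun n => by
    refine ⟨by positivity, ?_⟩
    rcases Nat.eq_zero_or_pos n with rfl | hn
    · simpa using hC
    · exact div_le_self hC (by exact_mod_cast hn)
  have bup : BddBelow (Set.range fun n : ℕ => (a n + C) / n) := by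
    refine ⟨-(|a 1| + C + C), ?_⟩
    rintro _ ⟨n, rfl⟩
    have h1 := (abs_le.1 (hdiv n)).1
    have h2 := (hCdiv n).1
    dsimp only
    rw [add_div]
    linarith
  have blo : BddBelow (Set.range fun n : ℕ => (C - a n) / n) := by
    refine ⟨-(|a 1| + C + C), ?_⟩
    rintro _ ⟨n, rfl⟩
    have h1 := (abs_le.1 (hdiv n)).2
    have h2 := (hCdiv n).1
    dsimp only
    rw [sub_div]
    linarith
  have hlim : hlo.lim = -hup.lim := by
    have h1 := hup.tendsto_lim bup
    have h2 := hlo.tendsto_lim blo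
    have h3 : Tendsto (fun n : ℕ => 2 * (C / (n : ℝ))) atTop (𝓝 (2 * 0)) :=
      (tendsto_const_div_atTop_nhds_zero_nat C).const_mul 2
    have h4 := tendsto_nhds_unique (h1.add h2) (h3.congr fun n => by ring)
    linarith
  refine ⟨hup.lim, fun n => ?_⟩
  rcases Nat.eq_zero_or_pos n with rfl | hn
  · have := abs_le.1 (h 0 0)
    rw [abs_le]
    constructor <;> push_cast <;> linarith
  · have hn' : (0 : ℝ) < n := by exact_mod_cast hn
    have h1 := hup.lim_le_div bup hn.ne'
    have h2 := hlo.lim_le_div blo hn.ne'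
    rw [le_div_iff₀ hn'] at h1 h2
    rw [hlim] at h2
    rw [abs_le]
    constructor <;> linarith

/-- The logarithm of `Lⁿ 1` is linear in `n` up to a bounded error. -/
theorem exists_abs_log_transferOperator_sub_le (hA : IsTransitionMatrix A)
    (hmix : IsTopologicallyMixing A) {g : MarkovShift A → ℝ} {G D : ℝ} (hG : ∀ x, |g x| ≤ G)
    (hD : HasBoundedDistortion g D) :
    ∃ p C : ℝ, ∀ (n : ℕ) (x), |Real.log ((transferOperator g ^ n) 1 x) - n * p| ≤ C := by
  obtain ⟨C, hC1, hC⟩ := exists_transferOperator_pow_one_le_mul hA hmix hG hD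
  have hC0 : 0 < C := by linarith
  have hpos := transferOperator_pow_one_pos hA g
  rcases isEmpty_or_nonempty (MarkovShift A) with he | ⟨⟨x₀⟩⟩
  · exact ⟨0, 0, fun n x => he.elim x⟩
  have hcmp : ∀ n x x', |Real.log ((transferOperator g ^ n) 1 x) -
      Real.log ((transferOperator g ^ n) 1 x')| ≤ Real.log C := by
    intro n x x'
    have h : ∀ x x', Real.log ((transferOperator g ^ n) 1 x) ≤
        Real.log C + Real.log ((transferOperator g ^ n) 1 x') := fun x x' => by
      rw [← Real.log_mul hC0.ne' (hpos n x').ne']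
      exact Real.log_le_log (hpos n x) (hC n x x')
    rw [abs_le]
    constructor <;> linarith [h x x', h x' x]
  -- Up to the factor `C`, `Lⁿ 1` is the constant `Lⁿ 1 (x₀)`, so `L^(m + n) 1 = L^m (Lⁿ 1)` nearly
  -- factors.
  have hquasi : ∀ m n, |Real.log ((transferOperator g ^ (m + n)) 1 x₀) -
      Real.log ((transferOperator g ^ m) 1 x₀) - Real.log ((transferOperator g ^ n) 1 x₀)| ≤
        Real.log C := by
    intro m n
    have hz : ∀ c : ℝ, (transferOperator g ^ m) (c • 1) x₀ = c * (transferOperator g ^ m) 1 x₀ :=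
      fun c => by rw [map_smul]; rfl
    have h1 : (transferOperator g ^ (m + n)) 1 x₀ ≤
        (C * (transferOperator g ^ n) 1 x₀) * (transferOperator g ^ m) 1 x₀ := by
      rw [pow_add, Module.End.mul_apply, ← hz]
      exact transferOperator_pow_mono g m (fun x => by simpa using hC n x x₀) x₀
    have h2 : (C⁻¹ * (transferOperator g ^ n) 1 x₀) * (transferOperator g ^ m) 1 x₀ ≤
        (transferOperator g ^ (m + n)) 1 x₀ := by
      rw [pow_add, Module.End.mul_apply, ← hz]
      refine transferOperator_pow_mono g m (fun x => ?_) x₀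
      simp only [Pi.smul_apply, Pi.one_apply, smul_eq_mul, mul_one]
      rw [inv_mul_le_iff₀ hC0]
      exact hC n x₀ x
    have hn := hpos n x₀
    have hm := hpos m x₀
    have h1' := Real.log_le_log (hpos _ _) h1
    have h2' := Real.log_le_log (by positivity) h2
    rw [Real.log_mul (by positivity) hm.ne', Real.log_mul (by positivity) hn.ne'] at h1' h2'
    rw [Real.log_inv] at h2'
    rw [abs_le]
    constructor <;> linarith
  obtain ⟨p, hp⟩ := exists_abs_sub_mul_le_of_quasiadditive
    (a := fun n => Real.log ((transferOperator g ^ n) 1 x₀)) hquasi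
  refine ⟨p, Real.log C + Real.log C, fun n x => ?_⟩
  have h1 := abs_le.1 (hcmp n x x₀)
  have h2 := abs_le.1 (hp n)
  rw [abs_le]
  constructor <;> linarith

/-- Raising the potential by `t` multiplies `Lⁿ 1` by `exp (n t)`. Comparison of growth rates for
different potentials rests on this. -/
theorem transferOperator_pow_one_le_of_le {g₁ g₂ : MarkovShift A → ℝ} {t : ℝ}
    (h : ∀ x, g₁ x ≤ g₂ x + t) (n : ℕ) (x : MarkovShift A) :
    (transferOperator g₁ ^ n) 1 x ≤ Real.exp (n * t) * (transferOperator g₂ ^ n) 1 x := by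
  classical
  induction n generalizing x with
  | zero => simp
  | succ n ih =>
    rw [pow_succ', pow_succ', Module.End.mul_apply, Module.End.mul_apply]
    refine (transferOperator_mono g₁ ih x).trans ?_
    rw [transferOperator_apply, transferOperator_apply, Finset.mul_sum]
    refine Finset.sum_le_sum fun a _ => ?_
    split_ifs with ha
    · have h1 : 0 ≤ (transferOperator g₂ ^ n) 1 (MarkovShift.cons a x ha) := by
        have := transferOperator_pow_mono g₂ n (f₁ := 0) (f₂ := 1)
          (fun _ => zero_le_one) (MarkovShift.cons a x ha)
        simpa using this
      have h2 := Real.exp_le_exp.2 (h (MarkovShift.cons a x ha))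
      have h3 : Real.exp ((n + 1 : ℕ) * t) = Real.exp (n * t) * Real.exp t := by
        rw [← Real.exp_add]; push_cast; ring_nf
      rw [Real.exp_add] at h2
      rw [h3]
      have := mul_le_mul_of_nonneg_right h2 (mul_nonneg (Real.exp_pos (n * t)).le h1)
      linarith
    · simp

theorem le_of_forall_nat_mul_le_add {a b C : ℝ} (h : ∀ n : ℕ, n * a ≤ n * b + C) : a ≤ b := by
  by_contra! hab
  obtain ⟨n, hn⟩ := exists_nat_gt (C / (a - b))
  rw [div_lt_iff₀ (by linarith)] at hn
  linarith [h n]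

/-- For some `P`, the iterates of the transfer operator of `φ - P ψ` applied to `1` are bounded away
from zero and infinity. -/
theorem exists_transferOperator_pow_one_bounded (hA : IsTransitionMatrix A)
    (hmix : IsTopologicallyMixing A) [Nonempty (MarkovShift A)]
    {φ ψ : MarkovShift A → ℝ} {B c D D' : ℝ} (hφ : ∀ x, |φ x| ≤ B) (hψ : ∀ x, |ψ x| ≤ B)
    (hc : 0 < c) (hψc : ∀ x, c ≤ ψ x) (hφD : HasBoundedDistortion φ D)
    (hψD : HasBoundedDistortion ψ D') :
    ∃ P K : ℝ, 1 ≤ K ∧ ∀ n x, K⁻¹ ≤ (transferOperator (fun x => φ x - P * ψ x) ^ n) 1 x ∧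
      (transferOperator (fun x => φ x - P * ψ x) ^ n) 1 x ≤ K := by
  have hB := abs_sub_mul_le hφ hψ
  have hDD := hφD.sub_mul hψD
  choose p C hp using fun β => exists_abs_log_transferOperator_sub_le hA hmix (hB β) (hDD β)
  obtain ⟨x₀⟩ := ‹Nonempty (MarkovShift A)›
  have hcomp : ∀ β β' t, (∀ x, φ x - β * ψ x ≤ φ x - β' * ψ x + t) → p β ≤ p β' + t := by
    intro β β' t h
    refine le_of_forall_nat_mul_le_add (C := C β + C β') fun n => ?_
    have h1 := Real.log_le_log (transferOperator_pow_one_pos hA _ n x₀)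
      (transferOperator_pow_one_le_of_le h n x₀)
    rw [Real.log_mul (Real.exp_pos _).ne' (transferOperator_pow_one_pos hA _ n x₀).ne',
      Real.log_exp] at h1
    have h2 := abs_le.1 (hp β n x₀)
    have h3 := abs_le.1 (hp β' n x₀)
    linarith
  have hlip : LipschitzWith (Real.toNNReal B) p := by
    refine LipschitzWith.of_le_add_mul _ fun β β' => ?_
    have hB0 : 0 ≤ B := (abs_nonneg _).trans (hψ x₀)
    rw [Real.coe_toNNReal _ hB0]
    refine hcomp _ _ _ fun x => ?_
    have h1 : (β' - β) * ψ x ≤ B * dist β β' := by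
      refine (le_abs_self _).trans ?_
      rw [abs_mul, Real.dist_eq, abs_sub_comm, mul_comm]
      exact mul_le_mul_of_nonneg_right (hψ x) (abs_nonneg _)
    linarith
  obtain ⟨P, hP⟩ : ∃ P, p P = 0 := by
    refine mem_range_of_exists_le_of_exists_ge hlip.continuous ?_ ?_
    -- Since `ψ ≥ c`, moving `β` by `|p 0| / c` changes the potential by at least `|p 0|`, enough to
    -- bring `p` to the other side of zero.
    · refine ⟨|p 0| / c, ?_⟩
      have := hcomp (|p 0| / c) 0 (-|p 0|) fun x => by
        have h1 := mul_le_mul_of_nonneg_left (hψc x) (div_nonneg (abs_nonneg (p 0)) hc.le)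
        rw [div_mul_cancel₀ _ hc.ne'] at h1
        linarith
      linarith [le_abs_self (p 0)]
    · refine ⟨-(|p 0| / c), ?_⟩
      have := hcomp 0 (-(|p 0| / c)) (-|p 0|) fun x => by
        have h1 := mul_le_mul_of_nonneg_left (hψc x) (div_nonneg (abs_nonneg (p 0)) hc.le)
        rw [div_mul_cancel₀ _ hc.ne'] at h1
        linarith
      linarith [neg_abs_le (p 0)]
  refine ⟨P, Real.exp (|C P|), Real.one_le_exp (abs_nonneg _), fun n x => ?_⟩
  have h1 := abs_le.1 (hp P n x)
  rw [hP, mul_zero, sub_zero] at h1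
  have hpos := transferOperator_pow_one_pos hA (fun x => φ x - P * ψ x) n x
  rw [← Real.exp_neg, ← Real.le_log_iff_exp_le hpos, ← Real.log_le_iff_le_exp hpos]
  constructor <;> linarith [le_abs_self (C P)]

end TransferOperator

/-! ### Positive functionals and Banach limits -/

section PositiveFunctional

/-- Bounded real functions on a type. -/
def IsBoundedFun {X : Type*} (f : X → ℝ) : Prop := ∃ B, ∀ x, |f x| ≤ B

theorem IsBoundedFun.add {X : Type*} {f g : X → ℝ} (hf : IsBoundedFun f) (hg : IsBoundedFun g) :
    IsBoundedFun (f + g) := by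
  obtain ⟨B, hB⟩ := hf
  obtain ⟨B', hB'⟩ := hg
  exact ⟨B + B', fun x => (abs_add_le _ _).trans (add_le_add (hB x) (hB' x))⟩

theorem IsBoundedFun.smul {X : Type*} {f : X → ℝ} (c : ℝ) (hf : IsBoundedFun f) :
    IsBoundedFun (c • f) := by
  obtain ⟨B, hB⟩ := hf
  refine ⟨|c| * B, fun x => ?_⟩
  rw [Pi.smul_apply, smul_eq_mul, abs_mul]
  exact mul_le_mul_of_nonneg_left (hB x) (abs_nonneg c)

theorem IsBoundedFun.mul {X : Type*} {f g : X → ℝ} (hf : IsBoundedFun f) (hg : IsBoundedFun g) :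
    IsBoundedFun (fun x => f x * g x) := by
  obtain ⟨B, hB⟩ := hf
  obtain ⟨B', hB'⟩ := hg
  refine ⟨B * B', fun x => ?_⟩
  rw [abs_mul]
  exact mul_le_mul (hB x) (hB' x) (abs_nonneg _) ((abs_nonneg _).trans (hB x))

theorem isBoundedFun_const {X : Type*} (c : ℝ) : IsBoundedFun (fun _ : X => c) :=
  ⟨|c|, fun _ => le_rfl⟩

/-- Positive linear functionals on the space of bounded functions; the values at unbounded functions
are irrelevant. -/
structure IsPositiveFunctional {X : Type*} (Λ : (X → ℝ) → ℝ) : Prop where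
  add : ∀ {f g}, IsBoundedFun f → IsBoundedFun g → Λ (f + g) = Λ f + Λ g
  smul : ∀ c {f}, IsBoundedFun f → Λ (c • f) = c * Λ f
  mono : ∀ {f g}, IsBoundedFun f → IsBoundedFun g → (∀ x, f x ≤ g x) → Λ f ≤ Λ g

theorem IsPositiveFunctional.const {X : Type*} {Λ : (X → ℝ) → ℝ} (hΛ : IsPositiveFunctional Λ)
    (c : ℝ) : Λ (fun _ => c) = c * Λ 1 := by
  rw [← hΛ.smul c (f := 1) (isBoundedFun_const 1)]
  congr 1
  funext x
  simp

theorem IsPositiveFunctional.abs_le {X : Type*} {Λ : (X → ℝ) → ℝ} (hΛ : IsPositiveFunctional Λ)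
    {f : X → ℝ} {B : ℝ} (hf : ∀ x, |f x| ≤ B) : |Λ f| ≤ B * Λ 1 := by
  have h1 := hΛ.mono (f := f) (g := fun _ => B) ⟨B, hf⟩ (isBoundedFun_const B)
    fun x => (_root_.abs_le.1 (hf x)).2
  have h2 := hΛ.mono (f := fun _ => -B) (g := f) (isBoundedFun_const _) ⟨B, hf⟩
    fun x => (_root_.abs_le.1 (hf x)).1
  rw [hΛ.const] at h1 h2
  rw [_root_.abs_le]
  constructor <;> linarith

/-- Existence of a Banach limit. -/
theorem exists_banachLimit : ∃ m : (ℕ → ℝ) → ℝ, IsPositiveFunctional m ∧ m 1 = 1 ∧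
    ∀ u, IsBoundedFun u → m (fun n => u (n + 1)) = m u := by
  -- The Banach limit is the limit of Cesàro averages along a non-principal ultrafilter; at `n = 0`
  -- the average is the default value `0`.
  let av : (ℕ → ℝ) → ℕ → ℝ := fun u n => (n : ℝ)⁻¹ * ∑ j ∈ Finset.range n, u j
  let m : (ℕ → ℝ) → ℝ := fun u => limUnder (hyperfilter ℕ : Filter ℕ) (av u)
  have hav : ∀ u B, (∀ n, |u n| ≤ B) → ∀ n, |av u n| ≤ B := by
    intro u B hB n
    have hB0 : 0 ≤ B := (abs_nonneg _).trans (hB 0)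
    rcases Nat.eq_zero_or_pos n with rfl | hn
    · simpa [av] using hB0
    · have hn' : (0 : ℝ) < n := by exact_mod_cast hn
      simp only [av]
      rw [abs_mul, abs_inv, Nat.abs_cast, inv_mul_le_iff₀ hn']
      refine (Finset.abs_sum_le_sum_abs _ _).trans ((Finset.sum_le_sum fun i _ => hB i).trans ?_)
      simp
  have hm : ∀ u, IsBoundedFun u → Tendsto (av u) (hyperfilter ℕ : Filter ℕ) (𝓝 (m u)) := by
    rintro u ⟨B, hB⟩
    obtain ⟨l, -, hl⟩ := (isCompact_Icc (a := -B) (b := B)).ultrafilter_le_nhds'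
      ((hyperfilter ℕ).map (av u))
      (Filter.univ_mem' (f := (hyperfilter ℕ : Filter ℕ)) fun n => abs_le.1 (hav u B hB n))
    exact tendsto_nhds_limUnder ⟨l, hl⟩
  refine ⟨m, ⟨fun {f g} hf hg => ?_, fun c {f} hf => ?_, fun {f g} hf hg h => ?_⟩, ?_,
    fun u hu => ?_⟩
  · refine tendsto_nhds_unique (hm _ (hf.add hg)) (((hm _ hf).add (hm _ hg)).congr fun n => ?_)
    simp [av, Finset.sum_add_distrib, mul_add]
  · refine tendsto_nhds_unique (hm _ (hf.smul c)) (((hm _ hf).const_mul c).congr fun n => ?_)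
    simp only [av, Pi.smul_apply, smul_eq_mul, ← Finset.mul_sum]
    ring
  · refine le_of_tendsto_of_tendsto' (hm _ hf) (hm _ hg) fun n => ?_
    exact mul_le_mul_of_nonneg_left (Finset.sum_le_sum fun i _ => h i) (by positivity)
  · refine tendsto_nhds_unique (hm 1 (isBoundedFun_const 1)) (tendsto_const_nhds.congr' ?_)
    refine Filter.Eventually.filter_mono Nat.hyperfilter_le_atTop ?_
    filter_upwards [eventually_gt_atTop 0] with n hn
    have : (n : ℝ) ≠ 0 := by exact_mod_cast hn.ne'
    simp [av, this]
  · have hu' : IsBoundedFun (fun n => u (n + 1)) := hu.imp fun B hB n => hB _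
    obtain ⟨B, hB⟩ := hu
    -- The difference of averages telescopes to `(u n - u 0) / n`.
    have h0 : Tendsto (fun n => av (fun n => u (n + 1)) n - av u n) atTop (𝓝 0) := by
      refine squeeze_zero_norm (fun n => ?_) (tendsto_const_div_atTop_nhds_zero_nat (2 * B))
      simp only [av]
      rw [← mul_sub, ← Finset.sum_sub_distrib, Finset.sum_range_sub, Real.norm_eq_abs, abs_mul,
        abs_inv, Nat.abs_cast, mul_comm, ← div_eq_mul_inv]
      refine div_le_div_of_nonneg_right ?_ (by positivity)
      have h1 := abs_le.1 (hB n)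
      have h2 := abs_le.1 (hB 0)
      rw [abs_le]
      constructor <;> linarith
    have h1 := (h0.mono_left Nat.hyperfilter_le_atTop).add (hm u ⟨B, hB⟩)
    rw [zero_add] at h1
    exact tendsto_nhds_unique (hm _ hu') (h1.congr fun n => by ring)

end PositiveFunctional

/-! ### Eigenfunctional and invariant Gibbs functional -/

section GibbsFunctional

variable {k : ℕ} {A : Matrix (Fin k) (Fin k) ℕ}

theorem abs_transferOperator_pow_le {g : MarkovShift A → ℝ} {K : ℝ}
    (hK : ∀ n x, (transferOperator g ^ n) 1 x ≤ K) {f : MarkovShift A → ℝ} {B : ℝ}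
    (hB : ∀ x, |f x| ≤ B) (n : ℕ) (x : MarkovShift A) : |(transferOperator g ^ n) f x| ≤ B * K := by
  have hB0 : 0 ≤ B := (abs_nonneg _).trans (hB x)
  have h1 := transferOperator_pow_mono g n (f₁ := f) (f₂ := B • 1)
    (fun y => by simpa using (abs_le.1 (hB y)).2) x
  have h2 := transferOperator_pow_mono g n (f₁ := (-B) • 1) (f₂ := f)
    (fun y => by simpa using (abs_le.1 (hB y)).1) x
  simp only [map_smul, Pi.smul_apply, smul_eq_mul] at h1 h2
  have h3 := mul_le_mul_of_nonneg_left (hK n x) hB0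
  rw [abs_le]
  constructor <;> linarith

/-- If the iterates `Lⁿ 1` are bounded, the transfer operator has a positive eigenfunctional. -/
theorem exists_eigenfunctional {g : MarkovShift A → ℝ} {K : ℝ} (x₀ : MarkovShift A)
    (hK : ∀ n x, K⁻¹ ≤ (transferOperator g ^ n) 1 x ∧ (transferOperator g ^ n) 1 x ≤ K) :
    ∃ ν : (MarkovShift A → ℝ) → ℝ, IsPositiveFunctional ν ∧ K⁻¹ ≤ ν 1 ∧ ν 1 ≤ K ∧
      ∀ f, IsBoundedFun f → ∀ n, ν ((transferOperator g ^ n) f) = ν f := by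
  obtain ⟨m, hm, hm1, hshift⟩ := exists_banachLimit
  have hbdd : ∀ {f : MarkovShift A → ℝ}, IsBoundedFun f →
      IsBoundedFun (fun j => (transferOperator g ^ j) f x₀) := by
    rintro f ⟨B, hB⟩
    exact ⟨B * K, fun n => abs_transferOperator_pow_le (fun n x => (hK n x).2) hB n x₀⟩
  have h1 : IsBoundedFun (1 : MarkovShift A → ℝ) := isBoundedFun_const 1
  -- Applying `L` to `f` shifts the sequence `j ↦ Lʲ f (x₀)`, so shift invariance of `m` gives
  -- eigenvalue `1`.
  refine ⟨fun f => m fun j => (transferOperator g ^ j) f x₀, ⟨fun {f f'} hf hf' => ?_,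
    fun c {f} hf => ?_, fun {f f'} hf hf' h => ?_⟩, ?_, ?_, fun f hf n => ?_⟩
  · rw [← hm.add (hbdd hf) (hbdd hf')]
    congr 1
    funext j
    simp
  · rw [← hm.smul c (hbdd hf)]
    congr 1
    funext j
    simp
  · exact hm.mono (hbdd hf) (hbdd hf') fun j => transferOperator_pow_mono g j h x₀
  · have := hm.mono (isBoundedFun_const K⁻¹) (hbdd h1) fun j => (hK j x₀).1
    rwa [hm.const, hm1, mul_one] at this
  · have := hm.mono (hbdd h1) (isBoundedFun_const K) fun j => (hK j x₀).2
    rwa [hm.const, hm1, mul_one] at this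
  · induction n with
    | zero => rfl
    | succ n ih =>
      rw [← ih]
      beta_reduce
      rw [← hshift _ (hbdd ⟨_, fun x => abs_transferOperator_pow_le
        (fun n x => (hK n x).2) hf.choose_spec n x⟩)]
      congr 1
      funext j
      rw [← Module.End.mul_apply, ← Module.End.mul_apply, ← pow_add, ← pow_add]
      rw [show j + (n + 1) = j + 1 + n by omega]

theorem isBoundedFun_indicator_one (s : Set (MarkovShift A)) :
    IsBoundedFun (s.indicator (1 : MarkovShift A → ℝ)) :=
  ⟨1, fun x => by
    by_cases h : x ∈ s <;> simp [h]⟩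

/-- A shift-invariant mean on bounded functions with the Gibbs property. -/
theorem exists_invariant_gibbs_functional (hmix : IsTopologicallyMixing A)
    {g : MarkovShift A → ℝ} {G D K : ℝ} (hG : ∀ x, |g x| ≤ G) (hD : HasBoundedDistortion g D)
    (hK1 : 1 ≤ K) (x₀ : MarkovShift A)
    (hK : ∀ n x, K⁻¹ ≤ (transferOperator g ^ n) 1 x ∧ (transferOperator g ^ n) 1 x ≤ K) :
    ∃ (Λ : (MarkovShift A → ℝ) → ℝ) (a b : ℝ), IsPositiveFunctional Λ ∧ Λ 1 = 1 ∧
      (∀ f, IsBoundedFun f → Λ (fun x => f (shiftMap A x)) = Λ f) ∧ 0 < a ∧ 0 < b ∧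
      ∀ ω n, 1 ≤ n → a * Real.exp (birkhoffSum (shiftMap A) g n ω) ≤
          Λ ((shiftCylinder A ω n).indicator 1) ∧
        Λ ((shiftCylinder A ω n).indicator 1) ≤
          b * Real.exp (birkhoffSum (shiftMap A) g n ω) := by
  obtain ⟨ν, hν, hν1, hν1', hLν⟩ := exists_eigenfunctional x₀ hK
  obtain ⟨m, hm, hm1, hshift⟩ := exists_banachLimit
  obtain ⟨M, hM⟩ := hmix.exists_iterate_eq
  have hK0 : 0 < K := by linarith
  have hKi : 0 < K⁻¹ := inv_pos.2 hK0
  have hL1 : ∀ j x, |(transferOperator g ^ j) 1 x| ≤ K := fun j x =>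
    abs_le.2 ⟨by linarith [(hK j x).1], (hK j x).2⟩
  have hL1b : ∀ j, IsBoundedFun ((transferOperator g ^ j) 1) := fun j => ⟨K, hL1 j⟩
  -- `w f j` is `ν (f ∘ σʲ)` rewritten through `ν ∘ L = ν`. In this form the bounds on `Lʲ 1`
  -- compare it directly with `ν f`.
  let w : (MarkovShift A → ℝ) → ℕ → ℝ := fun f j =>
    ν (fun x => (transferOperator g ^ j) 1 x * f x)
  have hw : ∀ {f : MarkovShift A → ℝ}, IsBoundedFun f → IsBoundedFun (w f) := by
    rintro f ⟨B, hB⟩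
    refine ⟨K * B * ν 1, fun j => hν.abs_le fun x => ?_⟩
    rw [abs_mul]
    exact mul_le_mul (hL1 j x) (hB x) (abs_nonneg _) hK0.le
  have hpos : IsPositiveFunctional fun f => m (w f) := by
    refine ⟨fun {f f'} hf hf' => ?_, fun c {f} hf => ?_, fun {f f'} hf hf' h => ?_⟩
    · rw [← hm.add (hw hf) (hw hf')]
      congr 1
      funext j
      simp only [w, Pi.add_apply]
      rw [← hν.add ((hL1b j).mul hf) ((hL1b j).mul hf')]
      congr 1
      funext x
      simp only [Pi.add_apply]
      ring
    · rw [← hm.smul c (hw hf)]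
      congr 1
      funext j
      simp only [w, Pi.smul_apply, smul_eq_mul]
      rw [← hν.smul c ((hL1b j).mul hf)]
      congr 1
      funext x
      simp only [Pi.smul_apply, smul_eq_mul]
      ring
    · exact hm.mono (hw hf) (hw hf') fun j => hν.mono ((hL1b j).mul hf) ((hL1b j).mul hf')
        fun x => mul_le_mul_of_nonneg_left (h x) (hKi.le.trans (hK j x).1)
  have hinv : ∀ f, IsBoundedFun f → m (w fun x => f (shiftMap A x)) = m (w f) := by
    intro f hf
    rw [← hshift _ (hw hf)]
    congr 1
    funext j
    have hfs : IsBoundedFun fun x => f (shiftMap A x) := hf.imp fun B hB x => hB _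
    simp only [w]
    rw [← hLν _ ((hL1b j).mul hfs) 1, pow_one, transferOperator_comp_mul, pow_succ',
      Module.End.mul_apply]
  have hcmp : ∀ {f : MarkovShift A → ℝ}, IsBoundedFun f → (∀ x, 0 ≤ f x) →
      K⁻¹ * ν f ≤ m (w f) ∧ m (w f) ≤ K * ν f := by
    intro f hf hf0
    constructor
    · have := hm.mono (isBoundedFun_const (K⁻¹ * ν f)) (hw hf) fun j => by
        rw [← hν.smul _ hf]
        exact hν.mono (hf.smul _) ((hL1b j).mul hf) fun x =>
          mul_le_mul_of_nonneg_right (hK j x).1 (hf0 x)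
      rwa [hm.const, hm1, mul_one] at this
    · have := hm.mono (hw hf) (isBoundedFun_const (K * ν f)) fun j => by
        rw [← hν.smul _ hf]
        exact hν.mono ((hL1b j).mul hf) (hf.smul _) fun x =>
          mul_le_mul_of_nonneg_right (hK j x).2 (hf0 x)
      rwa [hm.const, hm1, mul_one] at this
  have hone : 0 < m (w 1) := by
    have := (hcmp (isBoundedFun_const 1) fun _ => zero_le_one).1
    exact (mul_pos hKi (hKi.trans_le hν1)).trans_le this
  have hup : ∀ ω n, ν ((shiftCylinder A ω n).indicator 1) ≤
      Real.exp D * K * Real.exp (birkhoffSum (shiftMap A) g n ω) := by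
    intro ω n
    have hb := isBoundedFun_indicator_one (shiftCylinder A ω n)
    rw [← hLν _ hb n]
    have h1 : ∀ x, (transferOperator g ^ n) ((shiftCylinder A ω n).indicator 1) x ≤
        Real.exp D * Real.exp (birkhoffSum (shiftMap A) g n ω) := by
      refine transferOperator_pow_le_of_support g n ω (by positivity)
        (fun y hy => Set.indicator_of_notMem hy _) fun y hy => ?_
      rw [Set.indicator_of_mem hy, Pi.one_apply, mul_one, ← Real.exp_add, Real.exp_le_exp]
      linarith [(abs_le.1 (hD n ω y hy)).2]
    have h2 := hν.mono ⟨_, fun x => abs_transferOperator_pow_le (fun n x => (hK n x).2)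
      hb.choose_spec n x⟩ (isBoundedFun_const _) h1
    rw [hν.const] at h2
    have h3 := mul_le_mul_of_nonneg_left hν1'
      (show 0 ≤ Real.exp D * Real.exp (birkhoffSum (shiftMap A) g n ω) by positivity)
    linarith
  -- Mixing gives a preimage `y` under `σ^(n + M)` in the cylinder of length `n + 1`. Since `S_n g
  -- (y) = S_{n+1} g (y) - g (σⁿ y)`, the mismatch of lengths costs `exp G`, and the other `M` terms
  -- cost `exp (M G)`.
  have hlo : ∀ ω n, Real.exp (-(D + M * G)) * K⁻¹ *
      Real.exp (birkhoffSum (shiftMap A) g (n + 1) ω) ≤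
        ν ((shiftCylinder A ω (n + 1)).indicator 1) * Real.exp G := by
    intro ω n
    have hb := isBoundedFun_indicator_one (shiftCylinder A ω (n + 1))
    rw [← hLν _ hb (n + M)]
    have h1 : ∀ x, Real.exp (-(D + M * G)) * Real.exp (birkhoffSum (shiftMap A) g (n + 1) ω) *
        Real.exp (-G) ≤
        (transferOperator g ^ (n + M)) ((shiftCylinder A ω (n + 1)).indicator 1) x := by
      intro x
      obtain ⟨y, hy, rfl⟩ := hM ω x n
      refine le_trans ?_ (exp_mul_le_transferOperator_pow g (n + M)
        (f := (shiftCylinder A ω (n + 1)).indicator 1)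
        (Set.indicator_nonneg fun _ _ => zero_le_one) y)
      rw [Set.indicator_of_mem hy, Pi.one_apply, mul_one, ← Real.exp_add, ← Real.exp_add,
        Real.exp_le_exp, birkhoffSum_add _ _ n M]
      have h2 := (abs_le.1 (hD (n + 1) ω y hy)).1
      rw [birkhoffSum_succ _ _ n y] at h2
      have h3 := (abs_le.1 (hG ((shiftMap A)^[n] y))).2
      have h4 := (abs_le.1 (abs_birkhoffSum_le hG M ((shiftMap A)^[n] y))).1
      linarith
    have h2 := hν.mono (isBoundedFun_const _) ⟨_, fun x => abs_transferOperator_pow_le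
      (fun n x => (hK n x).2) hb.choose_spec (n + M) x⟩ h1
    rw [hν.const] at h2
    have h3 := mul_le_mul_of_nonneg_left hν1
      (show 0 ≤ Real.exp (-(D + M * G)) * Real.exp (birkhoffSum (shiftMap A) g (n + 1) ω) *
        Real.exp (-G) by positivity)
    have h4 := mul_le_mul_of_nonneg_right (h3.trans h2) (Real.exp_pos G).le
    refine le_trans (le_of_eq ?_) h4
    have h5 : Real.exp (-G) * Real.exp G = 1 := by rw [← Real.exp_add]; simp
    linear_combination (-(Real.exp (-(D + M * G)) *
      Real.exp (birkhoffSum (shiftMap A) g (n + 1) ω) * K⁻¹)) * h5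
  refine ⟨fun f => (m (w 1))⁻¹ * m (w f),
    (m (w 1))⁻¹ * (K⁻¹ * (Real.exp (-(D + M * G)) * K⁻¹ * Real.exp (-G))),
    (m (w 1))⁻¹ * (K * (Real.exp D * K)), ⟨fun {f f'} hf hf' => ?_, fun c {f} hf => ?_,
      fun {f f'} hf hf' h => ?_⟩, inv_mul_cancel₀ hone.ne', fun f hf => congrArg _ (hinv f hf),
      by positivity, by positivity, fun ω n hn => ?_⟩
  · rw [hpos.add hf hf', mul_add]
  · rw [hpos.smul c hf]; ring
  · exact mul_le_mul_of_nonneg_left (hpos.mono hf hf' h) (inv_nonneg.2 hone.le)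
  · obtain ⟨h1, h2⟩ := hcmp (isBoundedFun_indicator_one (shiftCylinder A ω n))
      (Set.indicator_nonneg fun _ _ => zero_le_one)
    rw [mul_assoc, mul_assoc (m (w 1))⁻¹ (K * _)]
    refine ⟨mul_le_mul_of_nonneg_left (le_trans ?_ h1) (inv_nonneg.2 hone.le),
      mul_le_mul_of_nonneg_left (h2.trans ?_) (inv_nonneg.2 hone.le)⟩
    · rw [mul_assoc]
      refine mul_le_mul_of_nonneg_left ?_ hKi.le
      obtain ⟨n, rfl⟩ := Nat.exists_eq_add_of_le' hn
      have h4 := mul_le_mul_of_nonneg_right (hlo ω n) (Real.exp_pos (-G)).le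
      have h5 : Real.exp G * Real.exp (-G) = 1 := by rw [← Real.exp_add]; simp
      rw [mul_assoc (ν _), h5, mul_one] at h4
      linarith
    · rw [mul_assoc]
      exact mul_le_mul_of_nonneg_left (hup ω n) hK0.le

end GibbsFunctional

/-! ### From the functional to an invariant measure -/

section GibbsMeasure

variable {k : ℕ} {A : Matrix (Fin k) (Fin k) ℕ}

theorem compactSpace_markovShift : CompactSpace (MarkovShift A) := by
  refine isCompact_iff_compactSpace.1 (IsClosed.isCompact ?_ :
    IsCompact {ω : ℕ → Fin k | ∀ j, A (ω j) (ω (j + 1)) = 1})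
  rw [Set.ofPred_forall]
  refine isClosed_iInter fun j => ?_
  have : Continuous fun ω : ℕ → Fin k => A (ω j) (ω (j + 1)) := by
    have h : Continuous fun ω : ℕ → Fin k => (ω j, ω (j + 1)) := by fun_prop
    exact (continuous_of_discreteTopology (f := fun p : Fin k × Fin k => A p.1 p.2)).comp h
  exact isClosed_singleton.preimage this

theorem continuous_shiftMap : Continuous (shiftMap A) :=
  Continuous.subtype_mk (f := fun (x : MarkovShift A) j => x.1 (j + 1)) (continuous_pi fun j =>
    (continuous_apply (j + 1)).comp continuous_subtype_val) _

theorem isClopen_shiftCylinder (ω : MarkovShift A) (n : ℕ) : IsClopen (shiftCylinder A ω n) := by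
  have h : shiftCylinder A ω n =
      ⋂ l ∈ Finset.range n, (fun τ : MarkovShift A => τ.1 l) ⁻¹' {ω.1 l} := by
    ext τ
    simp [shiftCylinder]
  rw [h]
  exact isClopen_biInter_finset fun l _ => (isClopen_discrete _).preimage
    ((continuous_apply l).comp continuous_subtype_val)

/-- A positive normalized functional is represented on continuous functions by a probability
measure. -/
theorem exists_isProbabilityMeasure_integral_eq {X : Type*} [TopologicalSpace X] [CompactSpace X]
    [T2Space X] [MeasurableSpace X] [BorelSpace X] {Λ : (X → ℝ) → ℝ}
    (hΛ : IsPositiveFunctional Λ) (h1 : Λ 1 = 1) :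
    ∃ μ : Measure X, IsProbabilityMeasure μ ∧ ∀ f : X → ℝ, Continuous f → ∫ x, f x ∂μ = Λ f := by
  have hb : ∀ {f : X → ℝ}, Continuous f → IsBoundedFun f := fun {f} hf => by
    obtain ⟨B, hB⟩ := isCompact_univ.exists_bound_of_continuousOn hf.continuousOn
    exact ⟨B, fun x => hB x trivial⟩
  -- Only the restriction to continuous functions is represented; on other bounded functions `Λ`
  -- need not agree with an integral.
  let Λ' : CompactlySupportedContinuousMap X ℝ →ₚ[ℝ] ℝ :=
    PositiveLinearMap.mk₀
      { toFun := fun f => Λ f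
        map_add' := fun f g => hΛ.add (hb f.continuous) (hb g.continuous)
        map_smul' := fun c f => hΛ.smul c (hb f.continuous) }
      (fun f hf => by
        have := hΛ.mono (isBoundedFun_const 0) (hb f.continuous) hf
        rwa [hΛ.const, zero_mul] at this)
  have hint : ∀ f : X → ℝ, Continuous f → ∫ x, f x ∂(RealRMK.rieszMeasure Λ') = Λ f := fun f hf =>
    RealRMK.integral_rieszMeasure Λ' ⟨⟨f, hf⟩, HasCompactSupport.of_compactSpace f⟩
  have hfin : IsFiniteMeasure (RealRMK.rieszMeasure Λ') := inferInstance
  refine ⟨RealRMK.rieszMeasure Λ', ⟨?_⟩, hint⟩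
  have h2 := hint 1 continuous_const
  rw [h1] at h2
  simp only [Pi.one_apply, integral_const, smul_eq_mul, mul_one] at h2
  rw [← ENNReal.toReal_eq_one_iff]
  exact h2

/-- Invariance is tested on continuous functions, and indicators of cylinders are continuous because
cylinders are clopen. So both properties of the functional pass to its Riesz measure. -/
theorem exists_invariant_gibbs_measure (hmix : IsTopologicallyMixing A)
    {g : MarkovShift A → ℝ} {G D K : ℝ} (hG : ∀ x, |g x| ≤ G) (hD : HasBoundedDistortion g D)
    (hK1 : 1 ≤ K) (x₀ : MarkovShift A)
    (hK : ∀ n x, K⁻¹ ≤ (transferOperator g ^ n) 1 x ∧ (transferOperator g ^ n) 1 x ≤ K) :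
    ∃ (μ : Measure (MarkovShift A)) (a b : ℝ), IsProbabilityMeasure μ ∧
      MeasurePreserving (shiftMap A) μ μ ∧ 0 < a ∧ 0 < b ∧
      ∀ ω n, 1 ≤ n → a * Real.exp (birkhoffSum (shiftMap A) g n ω) ≤
          μ.real (shiftCylinder A ω n) ∧
        μ.real (shiftCylinder A ω n) ≤ b * Real.exp (birkhoffSum (shiftMap A) g n ω) := by
  obtain ⟨Λ, a, b, hΛ, hΛ1, hinv, ha, hb, hgibbs⟩ :=
    exists_invariant_gibbs_functional hmix hG hD hK1 x₀ hK
  have := compactSpace_markovShift (A := A)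
  obtain ⟨μ, hμ, hμΛ⟩ := exists_isProbabilityMeasure_integral_eq hΛ hΛ1
  refine ⟨μ, a, b, hμ, ⟨continuous_shiftMap.measurable, ?_⟩, ha, hb, fun ω n hn => ?_⟩
  · have := Measure.isProbabilityMeasure_map (μ := μ)
      (continuous_shiftMap (A := A)).measurable.aemeasurable
    -- Any metric inducing the topology will do: it makes finite Borel measures determined by their
    -- integrals of bounded continuous functions.
    let := shiftMetric A 1 one_pos
    refine ext_of_forall_integral_eq_of_IsFiniteMeasure fun f => ?_
    rw [integral_map continuous_shiftMap.measurable.aemeasurable f.continuous.aestronglyMeasurable]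
    exact (hμΛ (fun x => f (shiftMap A x)) (f.continuous.comp continuous_shiftMap)).trans
      ((hinv f ⟨‖f‖, fun x => f.norm_coe_le_norm x⟩).trans (hμΛ f f.continuous).symm)
  · have hcl := isClopen_shiftCylinder ω n
    have hc : Continuous ((shiftCylinder A ω n).indicator (1 : MarkovShift A → ℝ)) :=
      continuous_one.indicator (by simp [hcl.frontier_eq])
    rw [← integral_indicator_one hcl.isOpen.measurableSet, hμΛ _ hc]
    exact hgibbs ω n hn

end GibbsMeasure

/-! ### Hölder functions have bounded distortion -/

section Holder

variable {k : ℕ} {A : Matrix (Fin k) (Fin k) ℕ}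

theorem IsHolderContinuous.exists_abs_sub_le {α : ℝ} (hα : 0 < α) {φ : MarkovShift A → ℝ}
    (hφ : letI := shiftMetric A α hα; IsHolderContinuous φ) :
    ∃ C θ : ℝ, 0 ≤ C ∧ 0 < θ ∧ θ < 1 ∧
      ∀ n x, ∀ y ∈ shiftCylinder A x n, |φ y - φ x| ≤ C * θ ^ n := by
  let := shiftMetric A α hα
  obtain ⟨C, r, hr, h⟩ := hφ
  have hr' : (0 : ℝ) < r := hr
  refine ⟨C, Real.exp (-(α * r)), C.2, Real.exp_pos _,
    by rw [Real.exp_lt_one_iff]; have := mul_pos hα hr'; linarith, fun n x y hy => ?_⟩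
  have h1 : dist x y ≤ Real.exp (-α * n) := shiftDist_le_of_mem_cylinder A hα x y n hy
  rw [← Real.dist_eq, dist_comm]
  refine (h.dist_le x y).trans (mul_le_mul_of_nonneg_left ?_ C.2)
  refine (Real.rpow_le_rpow dist_nonneg h1 hr'.le).trans (le_of_eq ?_)
  rw [← Real.exp_mul, ← Real.exp_nat_mul]
  congr 1
  ring

theorem IsHolderContinuous.continuous_of_shiftMetric {α : ℝ} (hα : 0 < α) {φ : MarkovShift A → ℝ}
    (hφ : letI := shiftMetric A α hα; IsHolderContinuous φ) : Continuous φ := by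
  let := shiftMetric A α hα
  obtain ⟨C, r, hr, h⟩ := hφ
  exact h.continuous hr

/-- On a cylinder of length `n`, the `i`-th term of the Birkhoff sum varies by at most `C θ^(n -
i)`, and the geometric series is bounded independently of `n`. -/
theorem IsHolderContinuous.exists_hasBoundedDistortion {α : ℝ} (hα : 0 < α)
    {φ : MarkovShift A → ℝ} (hφ : letI := shiftMetric A α hα; IsHolderContinuous φ) :
    ∃ D, HasBoundedDistortion φ D := by
  obtain ⟨C, θ, hC, hθ, hθ1, h⟩ := IsHolderContinuous.exists_abs_sub_le hα hφ
  have hE : 0 ≤ C / (1 - θ) := div_nonneg hC (by linarith)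
  have hCE : C = C / (1 - θ) * (1 - θ) := (div_mul_cancel₀ _ (by linarith)).symm
  generalize C / (1 - θ) = E at hE hCE
  subst hCE
  -- With `C = E (1 - θ)`, the bound `E (1 - θ ^ n)` is strong enough to reproduce itself in the
  -- induction.
  have key : ∀ n x, ∀ y ∈ shiftCylinder A x n,
      |birkhoffSum (shiftMap A) φ n y - birkhoffSum (shiftMap A) φ n x| ≤ E * (1 - θ ^ n) := by
    intro n
    induction n with
    | zero => simp
    | succ n ih =>
      intro x y hy
      have h1 := ih (shiftMap A x) (shiftMap A y) fun l hl => hy (l + 1) (by omega)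
      have h2 := h (n + 1) x y hy
      rw [birkhoffSum_succ', birkhoffSum_succ', add_sub_add_comm]
      refine (abs_add_le _ _).trans ((add_le_add h2 h1).trans ?_)
      have h3 : 0 ≤ E * ((1 - θ) * (1 - θ) * θ ^ n) := by
        have : 0 ≤ 1 - θ := by linarith
        positivity
      rw [pow_succ]
      linarith
  refine ⟨E, fun n x y hy => (key n x y hy).trans ?_⟩
  have := mul_nonneg hE (pow_nonneg hθ.le n)
  linarith

end Holder

/-! ### Spanning sums and identification of the pressure -/

section Pressure

variable {k : ℕ} {A : Matrix (Fin k) (Fin k) ℕ}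

/-- Every set of points contains a finite set of representatives of the cylinders of length `n` that
it meets. -/
theorem exists_finite_cylinder_transversal (s : Set (MarkovShift A)) (n : ℕ) :
    ∃ E ⊆ s, E.Finite ∧ (∀ y ∈ s, ∃ x ∈ E, y ∈ shiftCylinder A x n) ∧
      ∀ x ∈ E, ∀ y ∈ E, y ∈ shiftCylinder A x n → x = y := by
  let w : MarkovShift A → Fin n → Fin k := fun x i => x.1 i
  obtain ⟨E, hE, hbij⟩ := Set.exists_subset_bijOn s w
  refine ⟨E, hE, ?_, fun y hy => ?_, fun x hx y hy hxy => ?_⟩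
  · exact Set.Finite.of_finite_image (Set.toFinite _) hbij.injOn
  · obtain ⟨x, hx, hxy⟩ := hbij.surjOn (Set.mem_image_of_mem w hy)
    exact ⟨x, hx, fun l hl => (congrFun hxy ⟨l, hl⟩).symm⟩
  · exact hbij.injOn hx hy (funext fun i => (hxy i i.2).symm)

/-- Points with different first symbols are at distance exactly `1`, so Bowen distance below `1`
forces agreement at each of the first `n` places. -/
theorem mem_shiftCylinder_of_bowenDist_lt_one {α : ℝ} (hα : 0 < α) {n : ℕ} {x y : MarkovShift A}
    (h : letI := shiftMetric A α hα; bowenDist (shiftMap A) n x y < 1) :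
    y ∈ shiftCylinder A x n := by
  let := shiftMetric A α hα
  intro l hl
  have h2 : dist ((shiftMap A)^[l] x) ((shiftMap A)^[l] y) < 1 :=
    (le_ciSup (f := fun i : Fin n => dist ((shiftMap A)^[i] x) ((shiftMap A)^[i] y))
      (Set.finite_range _).bddAbove ⟨l, hl⟩).trans_lt h
  by_contra hne
  have h3 : (shiftMap A)^[l] x ≠ (shiftMap A)^[l] y := fun he => hne (by
    have := congrArg (fun z : MarkovShift A => z.1 0) he
    simp only [iterate_shiftMap_apply, zero_add] at this
    exact this.symm)
  have h4 : PiNat.firstDiff ((shiftMap A)^[l] x).1 ((shiftMap A)^[l] y).1 = 0 := by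
    by_contra h0
    have := PiNat.apply_eq_of_lt_firstDiff (Nat.pos_of_ne_zero h0)
    rw [iterate_shiftMap_apply, iterate_shiftMap_apply, zero_add] at this
    exact hne this.symm
  have h5 : dist ((shiftMap A)^[l] x) ((shiftMap A)^[l] y) = 1 := by
    change shiftDist A α _ _ = 1
    rw [shiftDist, if_neg h3, h4]
    simp
  linarith

theorem bowenDist_le_of_mem_shiftCylinder {α : ℝ} (hα : 0 < α) {n m : ℕ} {x y : MarkovShift A}
    (h : y ∈ shiftCylinder A x (n + m)) :
    letI := shiftMetric A α hα
    bowenDist (shiftMap A) n x y ≤ Real.exp (-α * m) := by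
  let := shiftMetric A α hα
  refine Real.iSup_le (fun i => ?_) (Real.exp_pos _).le
  refine shiftDist_le_of_mem_cylinder A hα _ _ m fun l hl => ?_
  rw [iterate_shiftMap_apply, iterate_shiftMap_apply]
  exact h _ (by omega)

theorem mul_le_birkhoffSum {ψ : MarkovShift A → ℝ} {c : ℝ} (h : ∀ x, c ≤ ψ x) (n : ℕ)
    (x : MarkovShift A) : n * c ≤ birkhoffSum (shiftMap A) ψ n x := by
  have := Finset.card_nsmul_le_sum (Finset.range n) (fun i => ψ ((shiftMap A)^[i] x)) c
    fun i _ => h _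
  simpa [birkhoffSum] using this

/-- The level sets cover the space. -/
theorem exists_mem_levelSet {ψ : MarkovShift A → ℝ} {c B T : ℝ} (hc : 0 < c)
    (hψc : ∀ x, c ≤ ψ x) (hψ : ∀ x, ψ x ≤ B) (hT : B ≤ T) (x : MarkovShift A) :
    ∃ n ∈ returnTimes (shiftMap A) ψ T, x ∈ levelSet (shiftMap A) ψ T n := by
  classical
  have hex : ∃ N : ℕ, T < birkhoffSum (shiftMap A) ψ N x := by
    obtain ⟨N, hN⟩ := exists_nat_gt (T / c)
    rw [div_lt_iff₀ hc] at hN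
    exact ⟨N, hN.trans_le (mul_le_birkhoffSum hψc N x)⟩
  have hlt := Nat.find_spec hex
  have hmin := fun {j} => Nat.find_min (H := hex) (m := j)
  -- `N` is the first time the Birkhoff sum exceeds `T`, and the level is `N - 1`. The assumption `T
  -- ≥ B` gives `N ≥ 2`, hence a positive level, as `returnTimes` demands.
  generalize Nat.find hex = N at hlt hmin
  have hN1 : 1 < N := by
    by_contra! hN
    interval_cases N
    · rw [birkhoffSum_zero] at hlt
      linarith [hψc x, hψ x]
    · rw [birkhoffSum_one] at hlt
      linarith [hψ x]
  obtain ⟨n, rfl⟩ := Nat.exists_eq_add_of_lt hN1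
  have hx : x ∈ levelSet (shiftMap A) ψ T (1 + n) :=
    ⟨not_lt.1 (hmin (Nat.lt_succ_self _)), hlt⟩
  exact ⟨1 + n, ⟨by omega, x, hx⟩, hx⟩

/-- The lower Gibbs estimate of the spanning sums. -/
theorem le_spanningSum_of_gibbs {α : ℝ} (hα : 0 < α) {φ ψ : MarkovShift A → ℝ} {B c D P b : ℝ}
    (hc : 0 < c) (hψc : ∀ x, c ≤ ψ x) (hψ : ∀ x, ψ x ≤ B) (hψD : HasBoundedDistortion ψ D)
    (μ : Measure (MarkovShift A)) [IsProbabilityMeasure μ] (hb : 0 < b)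
    (hμ : ∀ ω n, 1 ≤ n → μ.real (shiftCylinder A ω n) ≤
      b * Real.exp (birkhoffSum (shiftMap A) φ n ω - P * birkhoffSum (shiftMap A) ψ n ω)) :
    ∃ C : ℝ, 0 < C ∧ ∀ ε < 1, ∀ T ≥ B, ENNReal.ofReal (C * Real.exp (P * T)) ≤
      letI := shiftMetric A α hα
      spanningSum (shiftMap A) ψ φ T ε := by
  let := shiftMetric A α hα
  refine ⟨b⁻¹ * Real.exp (-(|P| * (B + D))), by positivity, fun ε hε T hT => ?_⟩
  refine le_iInf₂ fun F hF => ?_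
  set C' := b * Real.exp (|P| * (B + D)) * Real.exp (-(P * T)) with hC'
  have hlevel : ∀ n ∈ returnTimes (shiftMap A) ψ T, μ (levelSet (shiftMap A) ψ T n) ≤
      ENNReal.ofReal C' *
        ∑' x : F n, ENNReal.ofReal (Real.exp (birkhoffSum (shiftMap A) φ n x)) := by
    intro n hn
    -- A spanning set may be uncountable and contain points far from `X_n`. Keeping only points
    -- whose cylinder meets `X_n` gives `S_n ψ = T + O(1)` there, and one representative per
    -- cylinder leaves a finite cover.
    let F' : Set (MarkovShift A) :=
      {x ∈ F n | ∃ y ∈ levelSet (shiftMap A) ψ T n, y ∈ shiftCylinder A x n}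
    obtain ⟨E, hEF, hE, hcov, -⟩ := exists_finite_cylinder_transversal F' n
    have hsub : levelSet (shiftMap A) ψ T n ⊆ ⋃ x ∈ E, shiftCylinder A x n := by
      intro y hy
      obtain ⟨x, hxF, hxy⟩ := hF n hn y hy
      have hyx := mem_shiftCylinder_of_bowenDist_lt_one hα (hxy.trans_lt hε)
      obtain ⟨z, hz, hxz⟩ := hcov x ⟨hxF, y, hy, hyx⟩
      exact Set.mem_biUnion hz fun l hl => (hyx l hl).trans (hxz l hl)
    calc μ (levelSet (shiftMap A) ψ T n) ≤ μ (⋃ x ∈ E, shiftCylinder A x n) := measure_mono hsub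
      _ ≤ ∑' x : E, μ (shiftCylinder A x n) := measure_biUnion_le μ hE.countable _
      _ ≤ ∑' x : E, ENNReal.ofReal C' *
          ENNReal.ofReal (Real.exp (birkhoffSum (shiftMap A) φ n x)) := by
        refine ENNReal.tsum_le_tsum fun x => ?_
        obtain ⟨-, y, ⟨hy1, hy2⟩, hyx⟩ := hEF x.2
        rw [← ENNReal.ofReal_mul (by positivity), ← ofReal_measureReal]
        refine ENNReal.ofReal_le_ofReal ((hμ x n hn.1).trans ?_)
        rw [hC', mul_assoc, mul_assoc, ← Real.exp_add, ← Real.exp_add]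
        refine mul_le_mul_of_nonneg_left (Real.exp_le_exp.2 ?_) hb.le
        have h1 := abs_le.1 (hψD n x y hyx)
        rw [birkhoffSum_succ] at hy2
        have h2 := hψ ((shiftMap A)^[n] y)
        have hB : 0 ≤ B := hc.le.trans ((hψc y).trans (hψ y))
        have h3 : |T - birkhoffSum (shiftMap A) ψ n x| ≤ B + D := by
          rw [abs_le]
          constructor <;> linarith
        have h4 : P * (T - birkhoffSum (shiftMap A) ψ n x) ≤ |P| * (B + D) := by
          refine (le_abs_self _).trans ?_
          rw [abs_mul]
          exact mul_le_mul_of_nonneg_left h3 (abs_nonneg _)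
        linarith
      _ ≤ ∑' x : F n, ENNReal.ofReal C' *
          ENNReal.ofReal (Real.exp (birkhoffSum (shiftMap A) φ n x)) :=
        ENNReal.tsum_mono_subtype (fun x => ENNReal.ofReal C' *
          ENNReal.ofReal (Real.exp (birkhoffSum (shiftMap A) φ n x)))
          fun x hx => (hEF hx).1
      _ = _ := ENNReal.tsum_mul_left
  -- The level sets cover a space of measure one, so summing the bounds on their measures forces the
  -- spanning sum to be at least `1 / C'`.
  have hone : 1 ≤ ENNReal.ofReal C' * ∑' n : returnTimes (shiftMap A) ψ T, ∑' x : F n,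
      ENNReal.ofReal (Real.exp (birkhoffSum (shiftMap A) φ n x)) := by
    have hcov : (Set.univ : Set (MarkovShift A)) ⊆
        ⋃ n ∈ returnTimes (shiftMap A) ψ T, levelSet (shiftMap A) ψ T n := fun x _ => by
      obtain ⟨n, hn, hx⟩ := exists_mem_levelSet hc hψc hψ hT x
      exact Set.mem_biUnion hn hx
    rw [← measure_univ (μ := μ), ← ENNReal.tsum_mul_left]
    refine (measure_mono hcov).trans ((measure_biUnion_le μ (Set.to_countable _) _).trans ?_)
    exact ENNReal.tsum_le_tsum fun n => hlevel n n.2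
  have hCC : b⁻¹ * Real.exp (-(|P| * (B + D))) * Real.exp (P * T) * C' = 1 := by
    rw [hC', Real.exp_neg, Real.exp_neg]
    field_simp
  have hmul := mul_le_mul_right hone
    (ENNReal.ofReal (b⁻¹ * Real.exp (-(|P| * (B + D))) * Real.exp (P * T)))
  rwa [mul_one, ← mul_assoc, ← ENNReal.ofReal_mul (by positivity), hCC, ENNReal.ofReal_one,
    one_mul] at hmul

/-- The upper Gibbs estimate of the spanning sums. -/
theorem spanningSum_le_of_gibbs {α : ℝ} (hα : 0 < α) {φ ψ : MarkovShift A → ℝ} {B c G P a : ℝ}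
    (hc : 0 < c) (hψc : ∀ x, c ≤ ψ x) (hψ : ∀ x, ψ x ≤ B) (hG : ∀ x, |φ x - P * ψ x| ≤ G)
    (μ : Measure (MarkovShift A)) [IsProbabilityMeasure μ] (ha : 0 < a)
    (hμ : ∀ ω n, 1 ≤ n → a * Real.exp (birkhoffSum (shiftMap A) (fun x => φ x - P * ψ x) n ω) ≤
      μ.real (shiftCylinder A ω n)) {ε : ℝ} (hε : 0 < ε) :
    ∃ C : ℝ, 0 < C ∧ ∀ T ≥ 1, (letI := shiftMetric A α hα
      spanningSum (shiftMap A) ψ φ T ε) ≤ ENNReal.ofReal (C * Real.exp (P * T) * T) := by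
  let := shiftMetric A α hα
  obtain ⟨m, hm⟩ : ∃ m : ℕ, Real.exp (-α * m) ≤ ε := by
    obtain ⟨m, hm⟩ := exists_nat_gt (-Real.log ε / α)
    refine ⟨m, ?_⟩
    rw [← Real.le_log_iff_exp_le hε]
    rw [div_lt_iff₀ hα] at hm
    linarith
  -- Resolution `ε` requires cylinders of length `n + m`: the `m` extra terms cost `m G`, and
  -- replacing `S_n ψ` by `T` on `X_n` costs `|P| B`.
  set C₁ := a⁻¹ * Real.exp (m * G + |P| * B) with hC₁
  refine ⟨C₁ * (1 / c + 1), by positivity, fun T hT => ?_⟩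
  choose E hEs hEfin hEcov hEinj using
    fun n => exists_finite_cylinder_transversal (levelSet (shiftMap A) ψ T n) (n + m)
  have hspan : ∀ n ∈ returnTimes (shiftMap A) ψ T,
      IsSpanningSet (shiftMap A) n ε (levelSet (shiftMap A) ψ T n) (E n) := fun n _ y hy => by
    obtain ⟨x, hx, hxy⟩ := hEcov n y hy
    exact ⟨x, hx, (bowenDist_le_of_mem_shiftCylinder hα hxy).trans hm⟩
  refine (iInf₂_le E hspan).trans ?_
  have hn : ∀ n ∈ returnTimes (shiftMap A) ψ T,
      ∑' x : E n, ENNReal.ofReal (Real.exp (birkhoffSum (shiftMap A) φ n x)) ≤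
        ENNReal.ofReal (C₁ * Real.exp (P * T)) := by
    intro n hn
    calc ∑' x : E n, ENNReal.ofReal (Real.exp (birkhoffSum (shiftMap A) φ n x))
        ≤ ∑' x : E n, ENNReal.ofReal (C₁ * Real.exp (P * T)) *
            μ (shiftCylinder A x.1 (n + m)) := by
          refine ENNReal.tsum_le_tsum fun x => ?_
          obtain ⟨hx1, hx2⟩ := hEs n x.2
          rw [← ofReal_measureReal, ← ENNReal.ofReal_mul (by positivity)]
          refine ENNReal.ofReal_le_ofReal (le_trans ?_ (mul_le_mul_of_nonneg_left
            (hμ x.1 (n + m) (by have := hn.1; omega)) (by positivity)))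
          have he : C₁ * Real.exp (P * T) * (a * Real.exp (birkhoffSum (shiftMap A)
              (fun x => φ x - P * ψ x) (n + m) x.1)) = Real.exp (m * G + |P| * B) *
              (Real.exp (P * T) * Real.exp (birkhoffSum (shiftMap A)
              (fun x => φ x - P * ψ x) (n + m) x.1)) := by
            rw [hC₁]
            field_simp
          rw [he, ← Real.exp_add, ← Real.exp_add, Real.exp_le_exp, birkhoffSum_add]
          have h1 := (abs_le.1 (abs_birkhoffSum_le hG m ((shiftMap A)^[n] x.1))).1
          rw [birkhoffSum_succ] at hx2
          have h3 := hψ ((shiftMap A)^[n] x.1)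
          have h4 : |birkhoffSum (shiftMap A) ψ n x.1 - T| ≤ B := by
            rw [abs_le]
            constructor <;> linarith [(hψc x.1).trans (hψ x.1)]
          have h5 : P * (birkhoffSum (shiftMap A) ψ n x.1 - T) ≤ |P| * B := by
            refine (le_abs_self _).trans ?_
            rw [abs_mul]
            exact mul_le_mul_of_nonneg_left h4 (abs_nonneg _)
          rw [birkhoffSum_sub_mul φ ψ P n]
          linarith
      _ = ENNReal.ofReal (C₁ * Real.exp (P * T)) *
            ∑' x : E n, μ (shiftCylinder A x.1 (n + m)) := ENNReal.tsum_mul_left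
      -- The chosen representatives have pairwise disjoint cylinders, so the measures add up to at
      -- most one.
      _ ≤ ENNReal.ofReal (C₁ * Real.exp (P * T)) * 1 := by
          refine mul_le_mul_right ?_ _
          have := (hEfin n).countable.to_subtype
          rw [← measure_iUnion]
          · exact prob_le_one
          · intro x y hxy
            refine Set.disjoint_left.2 fun z hzx hzy => hxy (Subtype.ext ?_)
            exact hEinj n x.1 x.2 y.1 y.2 fun l hl => (hzy l hl).symm.trans (hzx l hl)
          · exact fun x => (isClopen_shiftCylinder _ _).isOpen.measurableSet
      _ = _ := mul_one _
  -- On a non-empty level `n c ≤ S_n ψ ≤ T`, so there are only `O(T)` levels; this is the linear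
  -- factor in the final bound.
  have hsub : returnTimes (shiftMap A) ψ T ⊆ ↑(Finset.range (⌊T / c⌋₊ + 1)) := by
    rintro n ⟨-, x, hx, -⟩
    rw [Finset.coe_range, Set.mem_Iio, Nat.lt_succ_iff, Nat.le_floor_iff (by positivity),
      le_div_iff₀ hc]
    exact (mul_le_birkhoffSum hψc n x).trans hx
  calc ∑' n : returnTimes (shiftMap A) ψ T, ∑' x : E n,
        ENNReal.ofReal (Real.exp (birkhoffSum (shiftMap A) φ n x))
      ≤ ∑' _ : returnTimes (shiftMap A) ψ T, ENNReal.ofReal (C₁ * Real.exp (P * T)) :=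
        ENNReal.tsum_le_tsum fun n => hn n n.2
    _ ≤ ∑' _ : ((Finset.range (⌊T / c⌋₊ + 1) : Finset ℕ) : Set ℕ),
          ENNReal.ofReal (C₁ * Real.exp (P * T)) :=
        ENNReal.tsum_mono_subtype (fun _ => ENNReal.ofReal (C₁ * Real.exp (P * T))) hsub
    _ = ENNReal.ofReal ((⌊T / c⌋₊ + 1 : ℕ) * (C₁ * Real.exp (P * T))) := by
        rw [Finset.tsum_subtype' _ fun _ => ENNReal.ofReal (C₁ * Real.exp (P * T)),
          Finset.sum_const, Finset.card_range, nsmul_eq_mul,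
          ENNReal.ofReal_mul (Nat.cast_nonneg _), ENNReal.ofReal_natCast]
    _ ≤ _ := by
        refine ENNReal.ofReal_le_ofReal ?_
        have h1 : ((⌊T / c⌋₊ + 1 : ℕ) : ℝ) ≤ (1 / c + 1) * T := by
          push_cast
          have := Nat.floor_le (show 0 ≤ T / c by positivity)
          have h2 : T / c = 1 / c * T := by ring
          linarith
        have h3 := mul_le_mul_of_nonneg_right h1
          (show 0 ≤ C₁ * Real.exp (P * T) by positivity)
        linarith

/-- The constants and the factor `T` contribute `O(log T / T)`, so both bounds have exponential rate
`P`. -/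
theorem tendsto_log_spanningSum {Q : ℝ → ℝ≥0∞} {P C C' T₀ : ℝ} (hC : 0 < C) (hC' : 0 < C')
    (hlo : ∀ T ≥ T₀, ENNReal.ofReal (C * Real.exp (P * T)) ≤ Q T)
    (hup : ∀ T ≥ 1, Q T ≤ ENNReal.ofReal (C' * Real.exp (P * T) * T)) :
    Tendsto (fun T : ℝ => ((1 / T : ℝ) : EReal) * ENNReal.log (Q T)) atTop (𝓝 (P : EReal)) := by
  have hdiv : ∀ K : ℝ, Tendsto (fun T : ℝ => K / T) atTop (𝓝 0) := fun K =>
    tendsto_const_nhds.div_atTop tendsto_id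
  have hlog : Tendsto (fun T : ℝ => Real.log T / T) atTop (𝓝 0) :=
    Real.isLittleO_log_id_atTop.tendsto_div_nhds_zero
  have hreal : Tendsto (fun T : ℝ => 1 / T * Real.log (Q T).toReal) atTop (𝓝 P) := by
    refine tendsto_of_tendsto_of_tendsto_of_le_of_le'
      (g := fun T => Real.log C / T + P) (h := fun T => Real.log C' / T + P + Real.log T / T)
      ?_ ?_ ?_ ?_
    · simpa using (hdiv (Real.log C)).add_const P
    · simpa using ((hdiv (Real.log C')).add_const P).add hlog
    · filter_upwards [eventually_ge_atTop T₀, eventually_ge_atTop 1] with T hT hT1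
      have hT0 : 0 < T := by linarith
      have h1 := (ENNReal.ofReal_le_iff_le_toReal
        ((hup T hT1).trans_lt ENNReal.ofReal_lt_top).ne).1 (hlo T hT)
      have h2 := Real.log_le_log (by positivity) h1
      rw [Real.log_mul hC.ne' (Real.exp_pos _).ne', Real.log_exp] at h2
      rw [one_div_mul_eq_div, le_div_iff₀ hT0, add_mul, div_mul_cancel₀ _ hT0.ne']
      exact h2
    · filter_upwards [eventually_ge_atTop T₀, eventually_ge_atTop 1] with T hT hT1
      have hT0 : 0 < T := by linarith
      have h0 := (ENNReal.ofReal_le_iff_le_toReal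
        ((hup T hT1).trans_lt ENNReal.ofReal_lt_top).ne).1 (hlo T hT)
      have hpos : 0 < (Q T).toReal := (by positivity : 0 < C * Real.exp (P * T)).trans_le h0
      have h1 := ENNReal.toReal_le_of_le_ofReal (by positivity) (hup T hT1)
      have h2 := Real.log_le_log hpos h1
      rw [Real.log_mul (by positivity) hT0.ne', Real.log_mul hC'.ne' (Real.exp_pos _).ne',
        Real.log_exp] at h2
      rw [one_div_mul_eq_div, div_le_iff₀ hT0, add_mul, add_mul, div_mul_cancel₀ _ hT0.ne',
        div_mul_cancel₀ _ hT0.ne']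
      exact h2
  refine (EReal.tendsto_coe.2 hreal).congr' ?_
  filter_upwards [eventually_ge_atTop T₀, eventually_ge_atTop 1] with T hT hT1
  have h1 : Q T ≠ ∞ := ((hup T hT1).trans_lt ENNReal.ofReal_lt_top).ne
  have h2 : Q T ≠ 0 :=
    ((ENNReal.ofReal_pos.2 (by positivity : 0 < C * Real.exp (P * T))).trans_le (hlo T hT)).ne'
  rw [ENNReal.log_pos_real h2 h1, EReal.coe_mul]

end Pressure

/-! ### Assembly of the theorem -/

theorem proposition5p3 {k : ℕ} (hk : 1 ≤ k) (A : Matrix (Fin k) (Fin k) ℕ)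
    (hA : IsTransitionMatrix A) (hmix : IsTopologicallyMixing A)
    (α : ℝ) (hα : 0 < α) (φ ψ : MarkovShift A → ℝ)
    (hφ : letI := shiftMetric A α hα; IsHolderContinuous φ)
    (hψ : letI := shiftMetric A α hα; IsHolderContinuous ψ)
    (hψ_pos : ∀ ω, 0 < ψ ω) :
    ∃ μ : Measure (MarkovShift A),
      MeasurePreserving (shiftMap A) μ μ ∧ IsGibbsMeasure A α hα ψ φ μ := by
  have hcomp := compactSpace_markovShift (A := A)
  obtain ⟨x₀⟩ : Nonempty (MarkovShift A) := by
    obtain ⟨N, hN⟩ := hmix ⟨0, hk⟩ ⟨0, hk⟩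
    exact ⟨(hN (N + 1) (Nat.lt_succ_self N)).some⟩
  have : Nonempty (MarkovShift A) := ⟨x₀⟩
  have hφc := IsHolderContinuous.continuous_of_shiftMetric hα hφ
  have hψc := IsHolderContinuous.continuous_of_shiftMetric hα hψ
  obtain ⟨B₁, hB₁⟩ := isCompact_univ.exists_bound_of_continuousOn hφc.continuousOn
  obtain ⟨B₂, hB₂⟩ := isCompact_univ.exists_bound_of_continuousOn hψc.continuousOn
  have hφB : ∀ x, |φ x| ≤ max B₁ B₂ := fun x => (hB₁ x trivial).trans (le_max_left _ _)
  have hψB : ∀ x, |ψ x| ≤ max B₁ B₂ := fun x => (hB₂ x trivial).trans (le_max_right _ _)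
  generalize max B₁ B₂ = B at hφB hψB
  obtain ⟨xm, -, hxm⟩ := isCompact_univ.exists_isMinOn Set.univ_nonempty hψc.continuousOn
  have hc : ∀ x, ψ xm ≤ ψ x := fun x => hxm (Set.mem_univ x)
  obtain ⟨D, hD⟩ := IsHolderContinuous.exists_hasBoundedDistortion hα hφ
  obtain ⟨D', hD'⟩ := IsHolderContinuous.exists_hasBoundedDistortion hα hψ
  obtain ⟨P, K, hK1, hK⟩ :=
    exists_transferOperator_pow_one_bounded hA hmix hφB hψB (hψ_pos xm) hc hD hD'
  have hsum : ∀ n ω, birkhoffSum (shiftMap A) (fun x => φ x - P * ψ x) n ω =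
      birkhoffSum (shiftMap A) φ n ω - P * birkhoffSum (shiftMap A) ψ n ω := birkhoffSum_sub_mul φ ψ P
  have hG := abs_sub_mul_le hφB hψB P
  have hgD := hD.sub_mul hD' P
  obtain ⟨μ, a, b, hμ, hinv, ha, hb, hgibbs⟩ :=
    exists_invariant_gibbs_measure hmix hG hgD hK1 x₀ hK
  refine ⟨μ, hinv, hμ, P, ?_, ?_⟩
  · obtain ⟨C, hC, hlo⟩ := le_spanningSum_of_gibbs (φ := φ) (P := P) hα (hψ_pos xm) hc
      (fun x => (le_abs_self _).trans (hψB x)) hD' μ hb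
      fun ω n hn => by rw [← hsum]; exact (hgibbs ω n hn).2
    -- The limit in `ε` is trivial: for every `ε` in `(0, 1)` the upper growth rate already equals
    -- `P`.
    refine tendsto_const_nhds.congr' ?_
    filter_upwards [Ioo_mem_nhdsGT one_pos] with ε hε
    obtain ⟨C', hC', hup⟩ := spanningSum_le_of_gibbs (φ := φ) (P := P) hα (hψ_pos xm) hc
      (fun x => (le_abs_self _).trans (hψB x)) hG μ ha (fun ω n hn => (hgibbs ω n hn).1) hε.1
    exact (tendsto_log_spanningSum hC hC' (hlo ε hε.2) hup).limsup_eq.symm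
  · let E := Real.exp (D + |P| * D')
    have hE : 0 < E := Real.exp_pos _
    -- The bounds with `a` and `b` hold at the point `ι` defining the cylinder; `E` is the
    -- distortion cost of moving to `ω`. The sum exceeds `1` and both resulting constants.
    refine ⟨1 + a⁻¹ * E + b * E, by have : 0 < a⁻¹ * E := by positivity
                                    have : 0 < b * E := by positivity
                                    linarith, fun ι n hn ω hω => ?_⟩
    have hd := abs_le.1 (hgD n ι ω hω)
    obtain ⟨h1, h2⟩ := hgibbs ι n hn
    have hexp : -(birkhoffSum (shiftMap A) ψ n ω) * P + birkhoffSum (shiftMap A) φ n ω =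
        birkhoffSum (shiftMap A) (fun x => φ x - P * ψ x) n ω := by
      rw [hsum]
      ring
    rw [hexp]
    generalize birkhoffSum (shiftMap A) (fun x => φ x - P * ψ x) n ω = s at hd
    generalize birkhoffSum (shiftMap A) (fun x => φ x - P * ψ x) n ι = t at hd h1 h2
    have hst : Real.exp s ≤ E * Real.exp t := by
      rw [← Real.exp_add, Real.exp_le_exp]
      linarith
    have hts : Real.exp t ≤ E * Real.exp s := by
      rw [← Real.exp_add, Real.exp_le_exp]
      linarith
    have hs := Real.exp_pos s
    constructor
    · have hK0 : 0 < a⁻¹ * E := by positivity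
      have hle : (1 + a⁻¹ * E + b * E)⁻¹ ≤ (a⁻¹ * E)⁻¹ :=
        inv_anti₀ hK0 (by have : 0 < b * E := by positivity
                          linarith)
      refine hle.trans ?_
      rw [le_div_iff₀ hs, mul_inv, inv_inv, mul_assoc]
      refine le_trans (mul_le_mul_of_nonneg_left ?_ ha.le) h1
      rwa [inv_mul_le_iff₀ hE]
    · rw [div_le_iff₀ hs]
      refine h2.trans ((mul_le_mul_of_nonneg_left hts hb.le).trans ?_)
      rw [← mul_assoc]
      refine mul_le_mul_of_nonneg_right ?_ hs.le
      have : 0 < a⁻¹ * E := by positivity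
      linarith
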